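/- \textbf{Setting.} A $k$-flat is a $k$-dimensional linear subspace of $\mathbb{R}^d$. For points $P=(p_1,\dots,p_n)$ in $\mathbb{R}^d$ (repetitions allowed) and a flat $F$ let $\mathrm{Price}(P,F)=\sum_{i=1}^n \mathrm{dist}(p_i,F)^2$ (Euclidean distance), let $\mathrm{Opt}_k(P)$ be the minimum of $\mathrm{Price}(P,G)$ over all $k$-flats $G$, and let $N=nd$ be the input size. Running time is counted on a randomized real RAM: a machine with finitely many registers and arrays of natural numbers and of real numbers; unit-cost $+$, truncated $-$, $\cdot$ and comparison on natural numbers; unit-cost $+,-,\cdot,/,\sqrt{\ }$ and comparison on real numbers; unit-cost conversion of natural numbers to reals, but no rounding of reals; unit-cost independent uniform random reals in $[0,1]$; and, as usual for singular value decompositions, an instruction that writes an orthonormal basis of right singular vectors of a given $p\times q$ matrix, ordered by non-increasing singular values, at a cost of $(p+q)q^2$ (up to an additive constant) steps. \textbf{Lemma.} There is a randomized real RAM program (one for all inputs and parameters) such that for every constant $A$ there is a constant $C$, depending only on $A$, with the following property. Let $n\ge 1$, $1\le k\le d$, $0<\varepsilon\le 1$, $0<\delta<1$ and $c\ge 1$.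 Let $P$ be $n$ points in $\mathbb{R}^d$, and let $F$ be a flat in $\mathbb{R}^d$ of dimension $u\le A k$, given by a basis, with \[ \mathrm{Price}(P,F)\le c\cdot \mathrm{Opt}_k(P). \] Then the program, given $P$, the basis of $F$, $n,d,k,u$, $\varepsilon$, $\delta$ and $c$, always halts within \[ C\cdot N\cdot\frac{k}{\varepsilon}\cdot\bigl(1+\log (c/\delta)\bigr) \] steps and outputs a basis of a $k$-flat $G$, and with probability at least $1-\delta$ \[ \mathrm{Price}(P,G)\le (1+\varepsilon)\,\mathrm{Opt}_k(P). \] -/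

import Mathlib

open MeasureTheory

/-! ## Flats, prices and the optimal price -/

/-- The Euclidean space `ℝ^d`. -/
abbrev Pt (d : ℕ) : Type := EuclideanSpace ℝ (Fin d)

/-- The price of fitting the points `P 0, …, P (n-1)` to a flat (a linear subspace) `F`:
the sum of the squared Euclidean distances of the points to `F`. -/
noncomputable def price {n d : ℕ} (P : Fin n → Pt d) (F : Submodule ℝ (Pt d)) : ℝ :=
  ∑ i, Metric.infDist (P i) (F : Set (Pt d)) ^ 2

/-- The optimal price of fitting `P` to a `k`-flat (a linear subspace of dimension `k`). -/
noncomputable def optPrice {n d : ℕ} (P : Fin n → Pt d) (k : ℕ) : ℝ :=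
  ⨅ G : {G : Submodule ℝ (Pt d) // Module.finrank ℝ G = k}, price P G.1

/-! ## Singular value decomposition -/

/-- `b` is an orthonormal basis of right singular vectors of the matrix `A`, listed in the order
of non-increasing singular values `σ`. -/
def IsRightSingularBasis {p q : ℕ} (A : Matrix (Fin p) (Fin q) ℝ)
    (b : OrthonormalBasis (Fin q) ℝ (Pt q)) : Prop :=
  ∃ σ : Fin q → ℝ, Antitone σ ∧ (∀ j, 0 ≤ σ j) ∧
    ∀ j, (A.transpose * A).mulVec (b j).ofLp = σ j ^ 2 • (b j).ofLp

theorem exists_isRightSingularBasis {p q : ℕ} (A : Matrix (Fin p) (Fin q) ℝ) :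
    ∃ b, IsRightSingularBasis A b := by
  have hP : (A.transpose * A).PosSemidef := by
    simpa using Matrix.posSemidef_conjTranspose_mul_self A
  have hH := hP.isHermitian
  let e : Fin q ≃ Fin q := Tuple.sort (fun i => - hH.eigenvalues i)
  refine ⟨hH.eigenvectorBasis.reindex e.symm, fun j => Real.sqrt (hH.eigenvalues (e j)),
    ?_, fun j => Real.sqrt_nonneg _, fun j => ?_⟩
  · intro i j hij
    have h := Tuple.monotone_sort (fun i => - hH.eigenvalues i) hij
    simp only [Function.comp, neg_le_neg_iff] at h
    exact Real.sqrt_le_sqrt h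
  · rw [Real.sq_sqrt (hP.eigenvalues_nonneg _)]
    simpa using hH.mulVec_eigenvectorBasis (e j)

/-- An orthonormal basis of right singular vectors of `A`, in the order of non-increasing singular
values. -/
noncomputable def rightSingularBasis {p q : ℕ} (A : Matrix (Fin p) (Fin q) ℝ) :
    OrthonormalBasis (Fin q) ℝ (Pt q) :=
  Classical.choose (exists_isRightSingularBasis A)

/-! ## A randomized real RAM

A machine with finitely many (named by numbers, as many as a program mentions) registers and arrays
of natural numbers and of reals, an exact arithmetic on the reals, a source of independent uniform
random reals of `[0,1]`, and an instruction for the singular value decomposition that is charged its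
usual cost. Programs are structured: assignments, sequencing, branching and loops. -/

namespace RealRAM

/-- A memory configuration; `pos` counts the random numbers that were drawn so far. -/
structure State where
  nreg : ℕ → ℕ
  rreg : ℕ → ℝ
  narr : ℕ → ℕ → ℕ
  rarr : ℕ → ℕ → ℝ
  pos : ℕ

/-- Expressions for natural numbers (indices and counters); subtraction is truncated. -/
inductive NExp where
  | lit (m : ℕ)
  | reg (x : ℕ)
  | arr (a : ℕ) (i : NExp)
  | add (e f : NExp)
  | sub (e f : NExp)
  | mul (e f : NExp)

/-- Expressions for reals. There is no rounding operation. -/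
inductive RExp where
  | ofNat (e : NExp)
  | reg (x : ℕ)
  | arr (a : ℕ) (i : NExp)
  | add (e f : RExp)
  | sub (e f : RExp)
  | mul (e f : RExp)
  | div (e f : RExp)
  | sqrt (e : RExp)

/-- Tests. -/
inductive BExp where
  | nlt (e f : NExp)
  | rlt (e f : RExp)
  | not (b : BExp)
  | and (b b' : BExp)

/-- The value of an expression. -/
def NExp.eval (s : State) : NExp → ℕ
  | .lit m => m
  | .reg x => s.nreg x
  | .arr a i => s.narr a (i.eval s)
  | .add e f => e.eval s + f.eval s
  | .sub e f => e.eval s - f.eval s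
  | .mul e f => e.eval s * f.eval s

/-- The number of steps for evaluating an expression: one for each operation and each access. -/
def NExp.cost : NExp → ℕ
  | .lit _ => 1
  | .reg _ => 1
  | .arr _ i => i.cost + 1
  | .add e f => e.cost + f.cost + 1
  | .sub e f => e.cost + f.cost + 1
  | .mul e f => e.cost + f.cost + 1

/-- The value of an expression; dividing by zero gives zero, and so does the square root of a
negative number. -/
noncomputable def RExp.eval (s : State) : RExp → ℝ
  | .ofNat e => (e.eval s : ℝ)
  | .reg x => s.rreg x
  | .arr a i => s.rarr a (i.eval s)
  | .add e f => e.eval s + f.eval s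
  | .sub e f => e.eval s - f.eval s
  | .mul e f => e.eval s * f.eval s
  | .div e f => e.eval s / f.eval s
  | .sqrt e => Real.sqrt (e.eval s)

/-- The number of steps for evaluating an expression. -/
def RExp.cost : RExp → ℕ
  | .ofNat e => e.cost + 1
  | .reg _ => 1
  | .arr _ i => i.cost + 1
  | .add e f => e.cost + f.cost + 1
  | .sub e f => e.cost + f.cost + 1
  | .mul e f => e.cost + f.cost + 1
  | .div e f => e.cost + f.cost + 1
  | .sqrt e => e.cost + 1

/-- The truth value of a test. -/
def BExp.holds (s : State) : BExp → Prop
  | .nlt e f => e.eval s < f.eval s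
  | .rlt e f => e.eval s < f.eval s
  | .not b => ¬ b.holds s
  | .and b b' => b.holds s ∧ b'.holds s

/-- The number of steps for evaluating a test. -/
def BExp.cost : BExp → ℕ
  | .nlt e f => e.cost + f.cost + 1
  | .rlt e f => e.cost + f.cost + 1
  | .not b => b.cost + 1
  | .and b b' => b.cost + b'.cost + 1

/-- Programs. -/
inductive Cmd where
  | skip
  | nset (x : ℕ) (e : NExp)
  | rset (x : ℕ) (e : RExp)
  | nput (a : ℕ) (i e : NExp)
  | rput (a : ℕ) (i : NExp) (e : RExp)
  /-- put a fresh uniform random number of `[0,1]` into the real register `x` -/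
  | rand (x : ℕ)
  /-- read a `p × q` matrix from the real array `src` and write its right singular vectors, as the
  rows of a `q × q` matrix, into the real array `dst` (matrices are stored row by row) -/
  | svd (p q : NExp) (src dst : ℕ)
  | seq (c c' : Cmd)
  | ite (b : BExp) (c c' : Cmd)
  | loop (b : BExp) (c : Cmd)

/-- The `m × d` matrix that is stored row by row at the beginning of an array. -/
def readMatrix (a : ℕ → ℝ) (m d : ℕ) : Matrix (Fin m) (Fin d) ℝ :=
  Matrix.of fun i j => a (i * d + j)

/-- Store an `m × d` matrix row by row at the beginning of an array, and leave the other entries of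
the array as they are. -/
def writeMatrix {m d : ℕ} (M : Matrix (Fin m) (Fin d) ℝ) (a : ℕ → ℝ) : ℕ → ℝ := fun l =>
  if h : l / d < m ∧ 0 < d then M ⟨l / d, h.1⟩ ⟨l % d, Nat.mod_lt l h.2⟩ else a l

/-- `Exec ω c s t s'`: when the random numbers are `ω 0, ω 1, …`, the program `c`, started in the
state `s`, halts in the state `s'` after `t` steps. -/
inductive Exec (ω : ℕ → unitInterval) : Cmd → State → ℕ → State → Prop
  | skip (s : State) : Exec ω .skip s 1 s
  | nset (s : State) (x : ℕ) (e : NExp) :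
      Exec ω (.nset x e) s (e.cost + 1)
        { s with nreg := Function.update s.nreg x (e.eval s) }
  | rset (s : State) (x : ℕ) (e : RExp) :
      Exec ω (.rset x e) s (e.cost + 1)
        { s with rreg := Function.update s.rreg x (e.eval s) }
  | nput (s : State) (a : ℕ) (i e : NExp) :
      Exec ω (.nput a i e) s (i.cost + e.cost + 1)
        { s with narr := Function.update s.narr a
                  (Function.update (s.narr a) (i.eval s) (e.eval s)) }
  | rput (s : State) (a : ℕ) (i : NExp) (e : RExp) :
      Exec ω (.rput a i e) s (i.cost + e.cost + 1)
        { s with rarr := Function.update s.rarr a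
                  (Function.update (s.rarr a) (i.eval s) (e.eval s)) }
  | rand (s : State) (x : ℕ) :
      Exec ω (.rand x) s 1
        { s with rreg := Function.update s.rreg x (ω s.pos : ℝ), pos := s.pos + 1 }
  | svd (s : State) (p q : NExp) (src dst : ℕ) :
      Exec ω (.svd p q src dst) s
        (p.cost + q.cost + (p.eval s + q.eval s) * q.eval s ^ 2 + 1)
        { s with rarr := Function.update s.rarr dst
                  (writeMatrix
                    (Matrix.of fun i j =>
                      rightSingularBasis (readMatrix (s.rarr src) (p.eval s) (q.eval s)) i j)
                    (s.rarr dst)) }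
  | seq {s s' s'' : State} {c c' : Cmd} {t t' : ℕ} :
      Exec ω c s t s' → Exec ω c' s' t' s'' → Exec ω (.seq c c') s (t + t') s''
  | iteTrue {s s' : State} {b : BExp} {c c' : Cmd} {t : ℕ} :
      b.holds s → Exec ω c s t s' → Exec ω (.ite b c c') s (b.cost + t + 1) s'
  | iteFalse {s s' : State} {b : BExp} {c c' : Cmd} {t : ℕ} :
      ¬ b.holds s → Exec ω c' s t s' → Exec ω (.ite b c c') s (b.cost + t + 1) s'
  | loopDone {s : State} {b : BExp} {c : Cmd} :
      ¬ b.holds s → Exec ω (.loop b c) s (b.cost + 1) s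
  | loopStep {s s' s'' : State} {b : BExp} {c : Cmd} {t t' : ℕ} :
      b.holds s → Exec ω c s t s' → Exec ω (.loop b c) s' t' s'' →
        Exec ω (.loop b c) s (b.cost + t + t' + 1) s''

/-- The law of the random numbers: independent and uniform in `[0,1]`. -/
noncomputable def coins : Measure (ℕ → unitInterval) :=
  Measure.infinitePi fun _ : ℕ => (volume : Measure unitInterval)

/-- The start state for the points `P`, a flat of dimension `u` that is given by the basis `B`, the
target dimension `k`, and the parameters `ε`, `δ`, `c`. The points are the rows of a matrix in
the real array `0` and the basis vectors are the rows of a matrix in the real array `1`; the numbers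
`n, d, k, u` and `ε, δ, c` are in the first registers, and the rest of the memory is `0`. -/
noncomputable def start {n d u : ℕ} (P : Fin n → Pt d) (B : Fin u → Pt d) (k : ℕ) (ε δ c : ℝ) :
    State where
  nreg := fun x => [n, d, k, u].getD x 0
  rreg := fun x => [ε, δ, c].getD x 0
  narr := fun _ _ => 0
  rarr := fun a =>
    if a = 0 then writeMatrix (Matrix.of fun i j => P i j) (fun _ => 0)
    else if a = 1 then writeMatrix (Matrix.of fun i j => B i j) (fun _ => 0)
    else fun _ => 0
  pos := 0

/-- The flat that a program outputs: the span of the `k` rows that it has left in the real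
array `2`. -/
noncomputable def outputFlat (k d : ℕ) (s : State) : Submodule ℝ (Pt d) :=
  Submodule.span ℝ
    (Set.range fun i : Fin k => (WithLp.toLp 2 (readMatrix (s.rarr 2) k d i) : Pt d))

end RealRAM

/-! The algorithm is adaptive length-squared sampling. Let `V` be a flat, let `e i` be the residuals
of the points, and draw `s` points with probabilities proportional to `‖e i‖ ^ 2`. The projections
of the points to an optimal `k`-flat factor through at most `k` orthonormal coefficient vectors `u
j`, and arbitrary vectors `w j` span a flat of price at most Opt plus the sum of the `‖w j - ∑ i, u
j i • P i‖ ^ 2` (`exists_coeff`). Importance sampling gives unbiased estimates of these combinations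
that lie in the span of `V` and the sample, with total mean squared error at most `(k / s)` Price(V)
(`sum_prob_estimator_le`, `lintegral_sampleRound_le`). So the enlarged flat contains a flat of
dimension at most `k` whose expected price is at most Opt + `(k / s)` Price(V).

High probability comes from the potential `badPrice`, which vanishes as soon as `V` contains a `(1 +
ε)`-optimal flat. On failure the excess `D` over Opt is larger than `ε` Opt, so Opt + `D` ≤ `(1 + 1
/ ε) D`: the potential is controlled by the excess alone. With `s ≥ 4 k / ε` a round brings its
expectation down to at most Price(V)/2 (`lintegral_badPrice_round`), which is at most half of the
previous potential if `V` is bad. After `T` rounds from the given flat the expectation is at most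
`c` Opt / `2 ^ T`, while failure forces the potential to be at least Opt. Markov's inequality bounds
the failure probability by `c / 2 ^ T ≤ δ`.

For the running time, the residuals of all points are kept in memory, so adding a vector to the flat
costs O(nd) whatever its dimension is (`RealRAM.Runs.addRow`), and there are at most `T * s + u`
such steps. The best `k`-flat inside the final flat is read off from a singular value decomposition
of the coordinates in that flat (`price_topSingular_le`). If `T * s + u` reaches `n`, all points are
added instead of sampling; the dimension thus never exceeds `n`, which keeps the decomposition
within the budget. -/

/-! ## Residuals and prices -/

/-- `e` is the component of `x` that is orthogonal to `V`. -/
def IsResid {d : ℕ} (V : Submodule ℝ (Pt d)) (x e : Pt d) : Prop :=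
  x - e ∈ V ∧ ∀ y ∈ V, inner ℝ y e = 0

theorem IsResid.norm_sq_le {d : ℕ} {V : Submodule ℝ (Pt d)} {x e y : Pt d} (h : IsResid V x e)
    (hy : y ∈ V) : ‖e‖ ^ 2 ≤ ‖x - y‖ ^ 2 := by
  have h1 := h.2 _ (V.sub_mem h.1 hy)
  have h2 : x - y = (x - e - y) + e := by abel
  rw [h2, norm_add_sq_real, h1]
  nlinarith [sq_nonneg ‖x - e - y‖]

theorem IsResid.infDist_eq {d : ℕ} {V : Submodule ℝ (Pt d)} {x e : Pt d} (h : IsResid V x e) :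
    Metric.infDist x (V : Set (Pt d)) = ‖e‖ := by
  apply le_antisymm
  · have := Metric.infDist_le_dist_of_mem (x := x) (s := (V : Set (Pt d))) h.1
    simpa [dist_eq_norm] using this
  · refine (Metric.le_infDist ⟨0, V.zero_mem⟩).2 fun y hy => ?_
    rw [dist_eq_norm]
    exact (sq_le_sq₀ (norm_nonneg _) (norm_nonneg _)).1 (h.norm_sq_le hy)

theorem isResid_proj {d : ℕ} (V : Submodule ℝ (Pt d)) (x : Pt d) :
    IsResid V x (x - V.starProjection x) := by
  refine ⟨by simp, fun y hy => ?_⟩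
  exact V.inner_right_of_mem_orthogonal hy (V.sub_starProjection_mem_orthogonal x)

theorem isResid_bot {d : ℕ} (x : Pt d) : IsResid ⊥ x x := by
  simp [IsResid]

theorem IsResid.mem_of_eq_zero {d : ℕ} {V : Submodule ℝ (Pt d)} {x e : Pt d} (h : IsResid V x e)
    (he : e = 0) : x ∈ V := by
  simpa [he] using h.1

/-- Extending `V` by the direction of a residual. -/
theorem IsResid.span_sup {d : ℕ} {V : Submodule ℝ (Pt d)} {x e : Pt d} (h : IsResid V x e)
    {q : Pt d} {a : ℝ} (ha : a ≠ 0) (hq : e = a • q) :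
    V ⊔ Submodule.span ℝ {x} = V ⊔ Submodule.span ℝ {q} := by
  apply le_antisymm
  · refine sup_le le_sup_left ?_
    rw [Submodule.span_singleton_le_iff_mem]
    have : x = (x - e) + a • q := by rw [← hq]; abel
    rw [this]
    exact Submodule.add_mem _ (Submodule.mem_sup_left h.1)
      (Submodule.mem_sup_right (Submodule.smul_mem _ _ (Submodule.mem_span_singleton_self _)))
  · refine sup_le le_sup_left ?_
    rw [Submodule.span_singleton_le_iff_mem]
    have : q = a⁻¹ • (x - (x - e)) := by
      rw [sub_sub_cancel, hq, smul_smul, inv_mul_cancel₀ ha, one_smul]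
    rw [this]
    exact Submodule.smul_mem _ _ (Submodule.sub_mem _
      (Submodule.mem_sup_right (Submodule.mem_span_singleton_self _))
      (Submodule.mem_sup_left h.1))

/-- Updating a residual when a unit vector orthogonal to `V` is added to `V`. -/
theorem IsResid.deflate {d : ℕ} {V : Submodule ℝ (Pt d)} {x e : Pt d} (h : IsResid V x e)
    {q : Pt d} (hq : ∀ y ∈ V, inner ℝ y q = 0) (hq1 : inner ℝ q q = (1 : ℝ)) :
    IsResid (V ⊔ Submodule.span ℝ {q}) x (e - (inner ℝ e q : ℝ) • q) := by
  constructor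
  · have : x - (e - (inner ℝ e q : ℝ) • q) = (x - e) + (inner ℝ e q : ℝ) • q := by abel
    rw [this]
    exact Submodule.add_mem _ (Submodule.mem_sup_left h.1)
      (Submodule.mem_sup_right (Submodule.smul_mem _ _ (Submodule.mem_span_singleton_self _)))
  · intro y hy
    obtain ⟨v, hv, w, hw, rfl⟩ := Submodule.mem_sup.1 hy
    obtain ⟨b, rfl⟩ := Submodule.mem_span_singleton.1 hw
    simp only [inner_add_left, inner_sub_right, inner_smul_left, inner_smul_right, h.2 v hv,
      hq v hv, hq1, real_inner_comm e q]
    simp only [conj_trivial]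
    ring

theorem price_nonneg {n d : ℕ} (P : Fin n → Pt d) (F : Submodule ℝ (Pt d)) : 0 ≤ price P F :=
  Finset.sum_nonneg fun _ _ => sq_nonneg _

theorem price_eq_of_isResid {n d : ℕ} {P : Fin n → Pt d} {V : Submodule ℝ (Pt d)}
    {e : Fin n → Pt d} (h : ∀ i, IsResid V (P i) (e i)) : price P V = ∑ i, ‖e i‖ ^ 2 := by
  unfold price
  exact Finset.sum_congr rfl fun i _ => by rw [(h i).infDist_eq]

theorem price_le_of_mem {n d : ℕ} {P : Fin n → Pt d} {V : Submodule ℝ (Pt d)}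
    {y : Fin n → Pt d} (h : ∀ i, y i ∈ V) : price P V ≤ ∑ i, ‖P i - y i‖ ^ 2 := by
  rw [price_eq_of_isResid fun i => isResid_proj V (P i)]
  exact Finset.sum_le_sum fun i _ => (isResid_proj V (P i)).norm_sq_le (h i)

theorem price_anti {n d : ℕ} (P : Fin n → Pt d) {V W : Submodule ℝ (Pt d)} (h : V ≤ W) :
    price P W ≤ price P V := by
  rw [price_eq_of_isResid fun i => isResid_proj V (P i)]
  refine (price_le_of_mem (y := fun i => V.starProjection (P i)) fun i => h ?_)
  simp

theorem isResid_orthonormal {d : ℕ} {ι : Type*} [Fintype ι] {g : ι → Pt d} (hg : Orthonormal ℝ g)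
    (x : Pt d) : IsResid (Submodule.span ℝ (Set.range g)) x (x - ∑ a, (inner ℝ (g a) x : ℝ) • g a) := by
  classical
  constructor
  · rw [sub_sub_cancel]
    exact Submodule.sum_mem _ fun a _ => Submodule.smul_mem _ _ (Submodule.subset_span ⟨a, rfl⟩)
  · intro y hy
    induction hy using Submodule.span_induction with
    | mem y hy =>
      obtain ⟨a, rfl⟩ := hy
      rw [inner_sub_right, hg.inner_right_fintype, sub_self]
    | zero => simp
    | add y z _ _ hy hz => rw [inner_add_left, hy, hz, add_zero]
    | smul c y _ hy => rw [inner_smul_left, hy, mul_zero]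

/-- Pythagoras. Minimizing the price thus becomes maximizing the captured energy, a sum of values of
one quadratic form. -/
theorem price_orthonormal {n d : ℕ} (P : Fin n → Pt d) {ι : Type*} [Fintype ι] {g : ι → Pt d}
    (hg : Orthonormal ℝ g) : price P (Submodule.span ℝ (Set.range g)) =
      ∑ i, ‖P i‖ ^ 2 - ∑ a, ∑ i, (inner ℝ (g a) (P i) : ℝ) ^ 2 := by
  classical
  rw [price_eq_of_isResid fun i => isResid_orthonormal hg (P i), Finset.sum_comm,
    ← Finset.sum_sub_distrib]
  refine Finset.sum_congr rfl fun i _ => ?_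
  rw [norm_sub_sq_real, inner_sum, ← real_inner_self_eq_norm_sq (∑ a, _), hg.inner_sum]
  simp only [inner_smul_right, real_inner_comm (g _) (P i)]
  simp only [conj_trivial, ← pow_two]
  ring

/-! ## The best flat of small dimension inside a given flat -/

/-- Ky Fan's bound for a diagonal form. -/
theorem sum_mul_le_sum_top {r k : ℕ} {t τ : Fin r → ℝ} (hτ : Antitone τ) (hτ0 : ∀ j, 0 ≤ τ j)
    (ht0 : ∀ j, 0 ≤ t j) (ht1 : ∀ j, t j ≤ 1) (ht : ∑ j, t j ≤ k) :
    ∑ j, t j * τ j ≤ ∑ j : {j : Fin r // j.val < k}, τ j := by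
  classical
  rw [← Finset.sum_subtype (Finset.univ.filter fun j : Fin r => j.val < k) (by simp) τ,
    Finset.sum_filter]
  by_cases hk : k < r
  -- The first value outside the top `k` serves as a threshold: after subtracting `m`, each term is
  -- largest with weight one on the top indices and zero elsewhere, and the subtracted mass is at
  -- most `k * m`.
  · set m := τ ⟨k, hk⟩
    have h1 : ∑ j, t j * (τ j - m) ≤ ∑ j : Fin r, if j.val < k then τ j - m else 0 := by
      refine Finset.sum_le_sum fun j _ => ?_
      split_ifs with h
      · have : m ≤ τ j := hτ (Fin.le_def.2 h.le)
        nlinarith [ht1 j]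
      · have : τ j ≤ m := hτ (Fin.le_def.2 (not_lt.1 h))
        nlinarith [ht0 j]
    have h2 : ∑ j : Fin r, (if j.val < k then m else 0) = k * m := by
      rw [← Finset.sum_filter, Finset.sum_const, nsmul_eq_mul]
      congr 2
      have : (Finset.univ.filter fun j : Fin r => j.val < k) = Finset.Iio ⟨k, hk⟩ := by
        ext j; simp [Fin.lt_def]
      rw [this, Fin.card_Iio]
    have h3 : (∑ j, t j) * m ≤ k * m := mul_le_mul_of_nonneg_right ht (hτ0 _)
    have h4 : ∑ j : Fin r, (if j.val < k then τ j - m else 0) =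
        ∑ j : Fin r, (if j.val < k then τ j else 0) - ∑ j : Fin r, (if j.val < k then m else 0) := by
      rw [← Finset.sum_sub_distrib]
      exact Finset.sum_congr rfl fun j _ => by split_ifs <;> simp
    simp only [mul_sub, Finset.sum_sub_distrib, ← Finset.sum_mul] at h1
    linarith
  · refine Finset.sum_le_sum fun j _ => ?_
    rw [if_pos (by omega)]
    nlinarith [ht1 j, hτ0 j]

/-- The linear combination of an orthonormal family. -/
noncomputable def combine {r d : ℕ} (q : Fin r → Pt d) : Pt r →ₗ[ℝ] Pt d :=
  Fintype.linearCombination ℝ q ∘ₗ (WithLp.linearEquiv 2 ℝ (Fin r → ℝ)).toLinearMap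

theorem combine_apply {r d : ℕ} (q : Fin r → Pt d) (y : Pt r) : combine q y = ∑ l, y l • q l := by
  simp [combine, Fintype.linearCombination_apply]

theorem inner_combine {r d : ℕ} {q : Fin r → Pt d} (hq : Orthonormal ℝ q) (y z : Pt r) :
    inner ℝ (combine q y) (combine q z) = inner ℝ y z := by
  rw [combine_apply, combine_apply, hq.inner_sum, PiLp.inner_apply]
  refine Finset.sum_congr rfl fun l _ => ?_
  simp [mul_comm]

theorem range_combine {r d : ℕ} (q : Fin r → Pt d) :
    LinearMap.range (combine q) = Submodule.span ℝ (Set.range q) := by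
  rw [combine, LinearEquiv.range_comp, Fintype.range_linearCombination]

/-- The captured energy is the quadratic form of `M.transpose * M` in the coordinates `y`, and the
singular basis diagonalizes it. -/
theorem sum_inner_combine_sq {n r d : ℕ} {P : Fin n → Pt d} {q : Fin r → Pt d}
    {M : Matrix (Fin n) (Fin r) ℝ} (hM : ∀ i l, M i l = inner ℝ (q l) (P i))
    {b : OrthonormalBasis (Fin r) ℝ (Pt r)} {σ : Fin r → ℝ}
    (hσ : ∀ j, (M.transpose * M).mulVec (b j).ofLp = σ j ^ 2 • (b j).ofLp) (y : Pt r) :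
    ∑ i, (inner ℝ (combine q y) (P i) : ℝ) ^ 2 = ∑ j, (inner ℝ (b j) y : ℝ) ^ 2 * σ j ^ 2 := by
  have h1 : ∀ i, (inner ℝ (combine q y) (P i) : ℝ) = M.mulVec y.ofLp i := by
    intro i
    rw [combine_apply, sum_inner, Matrix.mulVec, dotProduct]
    refine Finset.sum_congr rfl fun l _ => ?_
    rw [inner_smul_left, hM]; simp [mul_comm]
  have h2 : ∑ i, (inner ℝ (combine q y) (P i) : ℝ) ^ 2 =
      dotProduct y.ofLp ((M.transpose * M).mulVec y.ofLp) := by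
    rw [← Matrix.mulVec_mulVec, Matrix.dotProduct_mulVec, Matrix.vecMul_transpose, dotProduct]
    exact Finset.sum_congr rfl fun i _ => by rw [h1, pow_two]
  have h3 : (M.transpose * M).mulVec y.ofLp = ∑ j, ((inner ℝ (b j) y : ℝ) * σ j ^ 2) • (b j).ofLp := by
    conv_lhs => rw [← b.sum_repr' y]
    rw [WithLp.ofLp_sum, Matrix.mulVec_sum]
    refine Finset.sum_congr rfl fun j _ => ?_
    rw [WithLp.ofLp_smul, Matrix.mulVec_smul, hσ, smul_smul]
  rw [h2, h3, dotProduct_sum]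
  refine Finset.sum_congr rfl fun j _ => ?_
  have : dotProduct y.ofLp (b j).ofLp = inner ℝ (b j) y := by
    rw [EuclideanSpace.inner_eq_star_dotProduct]; simp
  rw [dotProduct_smul, this, smul_eq_mul]
  ring

/-- An orthonormal basis of `G` pulls back to orthonormal coordinate vectors `y a`. The weight of `σ
j ^ 2` in the energy captured by `G` is `∑ a, ⟨b j, y a⟩ ^ 2`; it is at most one by Bessel, and the
weights add up to the dimension of `G`. So `sum_mul_le_sum_top` applies. -/
theorem price_topSingular_le {n r d k : ℕ} {P : Fin n → Pt d} {q : Fin r → Pt d}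
    (hq : Orthonormal ℝ q) {M : Matrix (Fin n) (Fin r) ℝ}
    (hM : ∀ i l, M i l = inner ℝ (q l) (P i))
    {b : OrthonormalBasis (Fin r) ℝ (Pt r)} (hb : IsRightSingularBasis M b)
    {G : Submodule ℝ (Pt d)} (hG : G ≤ Submodule.span ℝ (Set.range q))
    (hk : Module.finrank ℝ G ≤ k) :
    price P (Submodule.span ℝ (Set.range fun j : {j : Fin r // j.val < k} => combine q (b j))) ≤
      price P G := by
  obtain ⟨σ, hσa, hσ0, hσ⟩ := hb
  have hf : Orthonormal ℝ (fun j : {j : Fin r // j.val < k} => combine q (b j)) := by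
    have := b.orthonormal.comp _ (Subtype.val_injective (p := fun j : Fin r => j.val < k))
    classical
    rw [orthonormal_iff_ite] at this ⊢
    intro i j
    rw [inner_combine hq]
    exact this i j
  let g := stdOrthonormalBasis ℝ G
  have hg : Orthonormal ℝ (fun a => (g a : Pt d)) :=
    g.orthonormal.comp_linearIsometry G.subtypeₗᵢ
  have hspan : Submodule.span ℝ (Set.range fun a => (g a : Pt d)) = G := by
    have h1 := g.toBasis.span_eq
    have h2 : (Set.range fun a => (g a : Pt d)) = G.subtype '' Set.range g.toBasis := by
      rw [← Set.range_comp]; congr 1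
    rw [h2, Submodule.span_image, h1, Submodule.map_top, Submodule.range_subtype]
  have hy : ∀ a, ∃ y, combine q y = (g a : Pt d) := fun a => by
    have := hG (g a).2
    rw [← range_combine] at this
    exact this
  choose y hy using hy
  have hyo : Orthonormal ℝ y := by
    classical
    rw [orthonormal_iff_ite] at hg ⊢
    intro i j
    rw [← inner_combine hq, hy, hy]
    exact hg i j
  conv_rhs => rw [← hspan]
  rw [price_orthonormal P hf, price_orthonormal P hg]
  have e1 : ∑ a : {j : Fin r // j.val < k}, ∑ i, (inner ℝ (combine q (b a)) (P i) : ℝ) ^ 2 =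
      ∑ a : {j : Fin r // j.val < k}, σ a ^ 2 := by
    refine Finset.sum_congr rfl fun a _ => ?_
    rw [sum_inner_combine_sq hM hσ, Finset.sum_eq_single a.1]
    · simp
    · intro j _ hj
      rw [b.orthonormal.2 hj]; simp
    · simp
  have e2 : ∑ a, ∑ i, (inner ℝ (g a : Pt d) (P i) : ℝ) ^ 2 =
      ∑ j, (∑ a, (inner ℝ (b j) (y a) : ℝ) ^ 2) * σ j ^ 2 := by
    simp only [Finset.sum_mul]
    rw [Finset.sum_comm (γ := Fin r)]
    refine Finset.sum_congr rfl fun a _ => ?_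
    rw [← hy, sum_inner_combine_sq hM hσ]
  rw [e1, e2]
  refine sub_le_sub_left (sum_mul_le_sum_top (fun i j h => ?_) (fun _ => sq_nonneg _)
    (fun _ => Finset.sum_nonneg fun _ _ => sq_nonneg _) (fun j => ?_) ?_) _
  · exact pow_le_pow_left₀ (hσ0 _) (hσa h) 2
  · have := hyo.sum_inner_products_le (b j) (s := Finset.univ)
    simp only [b.orthonormal.1 j, Real.norm_eq_abs, sq_abs, real_inner_comm (b j)] at this
    simpa using this
  · rw [Finset.sum_comm]
    have : ∀ a, ∑ j, (inner ℝ (b j) (y a) : ℝ) ^ 2 = 1 := fun a => by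
      have := b.sum_sq_norm_inner_right (y a)
      simpa [hyo.1 a] using this
    simp only [this]
    simpa using hk

theorem optPrice_le {n d : ℕ} (P : Fin n → Pt d) {k : ℕ} {G : Submodule ℝ (Pt d)}
    (hG : Module.finrank ℝ G = k) : optPrice P k ≤ price P G :=
  ciInf_le (f := fun G : {G : Submodule ℝ (Pt d) // Module.finrank ℝ G = k} => price P G.1)
    ⟨0, by rintro _ ⟨G, rfl⟩; exact price_nonneg _ _⟩ ⟨G, hG⟩

/-- The optimal price is attained, also among the flats of dimension at most `k`. -/
theorem exists_price_eq_optPrice {n d k : ℕ} (P : Fin n → Pt d) (hk : k ≤ d) :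
    ∃ G : Submodule ℝ (Pt d), Module.finrank ℝ G = k ∧ price P G = optPrice P k ∧
      ∀ G' : Submodule ℝ (Pt d), Module.finrank ℝ G' ≤ k → optPrice P k ≤ price P G' := by
  let q := EuclideanSpace.basisFun (Fin d) ℝ
  let M : Matrix (Fin n) (Fin d) ℝ := Matrix.of fun i l => inner ℝ (q l) (P i)
  obtain ⟨b, hb⟩ := exists_isRightSingularBasis M
  have hsp : Submodule.span ℝ (Set.range q) = ⊤ := by
    have := q.toBasis.span_eq
    simpa using this
  -- With the standard basis the ambient flat is the whole space, so the top singular span beats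
  -- every competitor and no compactness argument is needed.
  have hopt : ∀ G' : Submodule ℝ (Pt d), Module.finrank ℝ G' ≤ k → _ := fun G' h =>
    price_topSingular_le (k := k) (P := P) q.orthonormal (fun _ _ => rfl) hb
      (G := G') (by rw [hsp]; exact le_top) h
  set f := fun j : {j : Fin d // j.val < k} => combine q (b j) with hf
  have hfo : Orthonormal ℝ f := by
    have := b.orthonormal.comp _ (Subtype.val_injective (p := fun j : Fin d => j.val < k))
    classical
    rw [orthonormal_iff_ite] at this ⊢
    intro i j
    rw [hf, inner_combine q.orthonormal]
    exact this i j
  have hfr : Module.finrank ℝ (Submodule.span ℝ (Set.range f)) = k := by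
    rw [finrank_span_eq_card hfo.linearIndependent, Fintype.card_subtype]
    rcases hk.lt_or_eq with h | rfl
    · have : (Finset.univ.filter fun j : Fin d => j.val < k) = Finset.Iio ⟨k, h⟩ := by
        ext j; simp [Fin.lt_def]
      rw [this, Fin.card_Iio]
    · simp
  have heq : price P (Submodule.span ℝ (Set.range f)) = optPrice P k := by
    refine le_antisymm ?_ (optPrice_le P hfr)
    have : Nonempty {G : Submodule ℝ (Pt d) // Module.finrank ℝ G = k} := ⟨⟨_, hfr⟩⟩
    exact le_ciInf fun G => hopt G.1 G.2.le
  exact ⟨_, hfr, heq, fun G' h => heq ▸ hopt G' h⟩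

/-! ## Length-squared sampling -/

/-- A factorization of a family of points of `G` through an orthonormal family of at most `dim G`
coefficient vectors. -/
theorem exists_orthonormal_factor {n d : ℕ} {G : Submodule ℝ (Pt d)} {y : Fin n → Pt d}
    (hy : ∀ i, y i ∈ G) : ∃ m ≤ Module.finrank ℝ G, ∃ (u : Fin m → Fin n → ℝ) (z : Fin m → Pt d),
      (∀ j j', ∑ i, u j i * u j' i = if j = j' then 1 else 0) ∧ ∀ i, y i = ∑ j, u j i • z j := by
  classical
  -- The image of `G` under `g ↦ (⟨y i, g⟩)` is the column space of the matrix with rows `y i`. An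
  -- orthonormal basis of it supplies the coefficient vectors.
  let c : Pt d →ₗ[ℝ] Pt n :=
    { toFun := fun g => WithLp.toLp 2 fun i => (inner ℝ (y i) g : ℝ)
      map_add' := fun a b => by ext i; simp [inner_add_right]
      map_smul' := fun a b => by ext i; simp [inner_smul_right] }
  let U := G.map c
  let b := stdOrthonormalBasis ℝ U
  refine ⟨Module.finrank ℝ U, Submodule.finrank_map_le c G, fun j i => (b j : Pt n) i,
    fun j => ∑ i, (b j : Pt n) i • y i, fun j j' => ?_, fun i => ?_⟩
  · have := orthonormal_iff_ite.1 b.orthonormal j j'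
    rw [← this, Submodule.coe_inner, PiLp.inner_apply]
    exact Finset.sum_congr rfl fun i _ => mul_comm _ _
  · refine ext_inner_right ℝ fun g => ?_
    -- Since all `y i` lie in `G`, replacing `g` by its projection to `G` does not change `c g`.
    have hg : c g ∈ U := by
      refine ⟨G.starProjection g, by simp, ?_⟩
      ext i
      change inner ℝ (y i) (G.starProjection g) = inner ℝ (y i) g
      have := G.inner_right_of_mem_orthogonal (hy i) (G.sub_starProjection_mem_orthogonal g)
      rw [inner_sub_right] at this
      linarith
    have h1 : (inner ℝ (y i) g : ℝ) = c g i := rfl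
    have h2 : c g = ∑ j, (inner ℝ (b j : Pt n) (c g) : ℝ) • (b j : Pt n) := by
      have := congrArg (Subtype.val) (b.sum_repr' ⟨c g, hg⟩)
      refine this.symm.trans ?_
      simp only [Submodule.coe_sum, Submodule.coe_smul]
      rfl
    rw [h1, h2, sum_inner]
    rw [WithLp.ofLp_sum, Finset.sum_apply]
    refine Finset.sum_congr rfl fun j _ => ?_
    rw [inner_smul_left, sum_inner, PiLp.smul_apply, smul_eq_mul, mul_comm, PiLp.inner_apply]
    simp only [conj_trivial, inner_smul_left]
    congr 1
    refine Finset.sum_congr rfl fun i' _ => ?_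
    exact mul_comm _ _

/-- Completing the square: for orthonormal coefficient vectors the error depends on `w` only through
the distances of the `w j` to their best values `∑ i, u j i • P i`. -/
theorem sum_norm_sub_factor_sq {n d m : ℕ} (P : Fin n → Pt d) {u : Fin m → Fin n → ℝ}
    (hu : ∀ j j', ∑ i, u j i * u j' i = if j = j' then 1 else 0) (w : Fin m → Pt d) :
    ∑ i, ‖P i - ∑ j, u j i • w j‖ ^ 2 =
      ∑ i, ‖P i‖ ^ 2 - ∑ j, ‖∑ i, u j i • P i‖ ^ 2 + ∑ j, ‖w j - ∑ i, u j i • P i‖ ^ 2 := by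
  have h1 : ∀ i, ‖P i - ∑ j, u j i • w j‖ ^ 2 = ‖P i‖ ^ 2 -
      2 * ∑ j, u j i * inner ℝ (w j) (P i) + ∑ j, ∑ j', u j i * u j' i * inner ℝ (w j) (w j') := by
    intro i
    rw [norm_sub_sq_real, ← real_inner_self_eq_norm_sq (∑ j, _), real_inner_comm]
    simp only [sum_inner, inner_sum, inner_smul_left, inner_smul_right, conj_trivial]
    congr 1
    refine Finset.sum_congr rfl fun j _ => ?_
    rw [Finset.mul_sum]
    refine Finset.sum_congr rfl fun j' _ => ?_
    rw [real_inner_comm]; ring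
  have h2 : ∑ i, ∑ j, ∑ j', u j i * u j' i * inner ℝ (w j) (w j') = ∑ j, ‖w j‖ ^ 2 := by
    rw [Finset.sum_comm]
    refine Finset.sum_congr rfl fun j _ => ?_
    rw [Finset.sum_comm]
    simp only [← Finset.sum_mul, hu]
    simp
  have h3 : ∑ i, ∑ j, u j i * inner ℝ (w j) (P i) = ∑ j, inner ℝ (w j) (∑ i, u j i • P i) := by
    rw [Finset.sum_comm]
    refine Finset.sum_congr rfl fun j _ => ?_
    simp only [inner_sum, inner_smul_right]
  have h4 : ∀ j, ‖w j - ∑ i, u j i • P i‖ ^ 2 = ‖w j‖ ^ 2 - 2 * inner ℝ (w j) (∑ i, u j i • P i) +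
      ‖∑ i, u j i • P i‖ ^ 2 := fun j => norm_sub_sq_real _ _
  simp only [h1, h4, Finset.sum_add_distrib, Finset.sum_sub_distrib, ← Finset.mul_sum, h2, h3]
  ring

/-- Coefficient vectors that turn approximations of the combinations of the points into a flat. -/
theorem exists_coeff {n d k : ℕ} (P : Fin n → Pt d) (hk : k ≤ d) :
    ∃ m ≤ k, ∃ u : Fin m → Fin n → ℝ, (∀ j, ∑ i, u j i ^ 2 = 1) ∧
      ∀ w : Fin m → Pt d, price P (Submodule.span ℝ (Set.range w)) ≤
        optPrice P k + ∑ j, ‖w j - ∑ i, u j i • P i‖ ^ 2 := by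
  obtain ⟨G, hGk, hG, -⟩ := exists_price_eq_optPrice P hk
  obtain ⟨m, hm, u, z, hu, hz⟩ := exists_orthonormal_factor
    (G := G) (y := fun i => G.starProjection (P i)) (fun i => by simp)
  refine ⟨m, hGk ▸ hm, u, fun j => by simpa [pow_two] using hu j j, fun w => ?_⟩
  have h1 : price P (Submodule.span ℝ (Set.range w)) ≤ ∑ i, ‖P i - ∑ j, u j i • w j‖ ^ 2 :=
    price_le_of_mem fun i => Submodule.sum_mem _ fun j _ =>
      Submodule.smul_mem _ _ (Submodule.subset_span ⟨j, rfl⟩)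
  have h2 : optPrice P k = ∑ i, ‖P i - ∑ j, u j i • z j‖ ^ 2 := by
    rw [← hG, price_eq_of_isResid fun i => isResid_proj G (P i)]
    exact Finset.sum_congr rfl fun i _ => by rw [hz i]
  rw [sum_norm_sub_factor_sq P hu] at h1 h2
  -- Dropping this term from the formula for the optimum shows that the part common to `h1` and `h2`
  -- is at most the optimum.
  have h3 : 0 ≤ ∑ j, ‖z j - ∑ i, u j i • P i‖ ^ 2 := Finset.sum_nonneg fun _ _ => sq_nonneg _
  linarith

/-- One sampling step of the estimator of the combination with the coefficients `u`. -/
theorem sum_prob_estimator_le {n d : ℕ} {e : Fin n → Pt d} {u : Fin n → ℝ} {W s : ℝ}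
    (hW : W = ∑ i, ‖e i‖ ^ 2) (hW0 : 0 < W) (hs : 0 < s) (hu : ∑ i, u i ^ 2 = 1) (D : Pt d) :
    ∑ i, (‖e i‖ ^ 2 / W) * ‖D + (u i / (s * (‖e i‖ ^ 2 / W))) • e i‖ ^ 2 ≤
      ‖D + (1 / s) • ∑ i, u i • e i‖ ^ 2 + W / s ^ 2 := by
  have h1 : ∀ i, (‖e i‖ ^ 2 / W) * ‖D + (u i / (s * (‖e i‖ ^ 2 / W))) • e i‖ ^ 2 ≤
      (‖e i‖ ^ 2 / W) * ‖D‖ ^ 2 + 2 * (u i / s) * inner ℝ D (e i) + W / s ^ 2 * u i ^ 2 := by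
    intro i
    -- A point with zero residual has probability zero; its term on the left vanishes, while `u i`
    -- may still contribute on the right. Otherwise equality holds.
    rcases eq_or_ne (e i) 0 with h | h
    · simp only [h]
      simp
      positivity
    · have hn : ‖e i‖ ≠ 0 := norm_ne_zero_iff.2 h
      rw [norm_add_sq_real, inner_smul_right, norm_smul, mul_pow, Real.norm_eq_abs, sq_abs]
      apply le_of_eq
      field_simp
  refine (Finset.sum_le_sum fun i _ => h1 i).trans ?_
  rw [Finset.sum_add_distrib, Finset.sum_add_distrib, ← Finset.sum_mul, ← Finset.sum_div, ← hW,
    div_self hW0.ne', ← Finset.mul_sum, hu, norm_add_sq_real, inner_smul_right, inner_sum]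
  have h2 : ∑ i, 2 * (u i / s) * inner ℝ D (e i) =
      2 * (1 / s * ∑ i, inner ℝ D (u i • e i)) := by
    simp only [Finset.mul_sum, inner_smul_right]
    exact Finset.sum_congr rfl fun i _ => by ring
  rw [h2]
  -- The second moment of the increment is bounded by `W / s ^ 2`; the square of its mean, which the
  -- variance would subtract, is given away.
  nlinarith [sq_nonneg ‖(1 / s) • ∑ i, u i • e i‖]

/-! ### Drawing an index by inverting the partial sums. -/

theorem exists_sel (w : ℕ → ℝ) (n : ℕ) (y : ℝ) :
    ∃ i, n ≤ i + 1 ∨ y ≤ ∑ l ∈ Finset.range (i + 1), w l := ⟨n, Or.inl (by omega)⟩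

open Classical in
/-- The index that is selected by the level `y` among weights `w 0, …, w (n - 1)`: the first one
whose partial sum reaches `y`. -/
noncomputable def sel (w : ℕ → ℝ) (n : ℕ) (y : ℝ) : ℕ := Nat.find (exists_sel w n y)

/-- The disjunct `n ≤ i + 1` stops the search at the last index even if no partial sum reaches the
level, exactly as the loop in `RealRAM.selectIndex` does. -/
theorem sel_lt {w : ℕ → ℝ} {n : ℕ} (hn : 0 < n) (y : ℝ) : sel w n y < n := by
  classical
  have : sel w n y ≤ n - 1 := Nat.find_min' _ (Or.inl (by omega))
  omega

theorem sel_eq_iff {w : ℕ → ℝ} {n : ℕ} {y : ℝ} {i : ℕ} : sel w n y = i ↔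
    (n ≤ i + 1 ∨ y ≤ ∑ l ∈ Finset.range (i + 1), w l) ∧
      ∀ j < i, ¬ (n ≤ j + 1 ∨ y ≤ ∑ l ∈ Finset.range (j + 1), w l) := by
  classical
  exact Nat.find_eq_iff _

theorem measurableSet_sel_eq (w : ℕ → ℝ) (n : ℕ) (i : ℕ) : MeasurableSet {y | sel w n y = i} := by
  have : {y : ℝ | sel w n y = i} =
      ({y | n ≤ i + 1} ∪ Set.Iic (∑ l ∈ Finset.range (i + 1), w l)) ∩
        ⋂ j ∈ Set.Iio i, ({y | n ≤ j + 1} ∪ Set.Iic (∑ l ∈ Finset.range (j + 1), w l))ᶜ := by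
    ext y
    simp [sel_eq_iff]
  rw [this]
  refine ((MeasurableSet.const _).union measurableSet_Iic).inter
    (MeasurableSet.biInter (Set.to_countable _) fun j _ =>
      ((MeasurableSet.const _).union measurableSet_Iic).compl)

theorem sel_spec {w : ℕ → ℝ} {n : ℕ} (hn : 0 < n) {ρ W : ℝ} (h0 : 0 ≤ ρ) (h1 : ρ ≤ 1)
    (hW : W = ∑ l ∈ Finset.range n, w l) (hW0 : 0 ≤ W) :
    ∑ l ∈ Finset.range (sel w n (ρ * W)), w l ≤ ρ * W ∧
      ρ * W ≤ ∑ l ∈ Finset.range (sel w n (ρ * W) + 1), w l := by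
  obtain ⟨h, h'⟩ := sel_eq_iff.1 (rfl : sel w n (ρ * W) = _)
  have hlt := sel_lt (w := w) hn (ρ * W)
  set i := sel w n (ρ * W)
  constructor
  · rcases Nat.eq_zero_or_pos i with hi | hi
    · rw [hi]; simp; positivity
    · have := h' (i - 1) (by omega)
      rw [Nat.sub_add_cancel hi] at this
      push Not at this
      exact this.2.le
  · rcases h with h | h
    · have : i + 1 = n := by omega
      rw [this, ← hW]
      nlinarith
    · exact h

theorem volume_unitInterval_le {W : ℝ} (hW : 0 < W) (a b : ℝ) :
    volume {ρ : unitInterval | a ≤ ρ.1 * W ∧ ρ.1 * W ≤ b} ≤ ENNReal.ofReal ((b - a) / W) := by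
  rw [Measure.Subtype.volume_def, comap_subtype_coe_apply measurableSet_Icc]
  refine (measure_mono (t := Set.Icc (a / W) (b / W)) ?_).trans ?_
  · rintro _ ⟨ρ, ⟨h1, h2⟩, rfl⟩
    exact ⟨(div_le_iff₀ hW).2 h1, (le_div_iff₀ hW).2 h2⟩
  · rw [Real.volume_Icc, sub_div]

/-- Only an upper bound is needed, so the event that `i` is selected may be enlarged to a closed
interval of length `w i / W`; the overlaps at the end points are harmless. -/
theorem lintegral_sel_le {w : ℕ → ℝ} {n : ℕ} (hn : 0 < n) {W : ℝ}
    (hW : W = ∑ l ∈ Finset.range n, w l) (hW0 : 0 < W) (f : ℕ → ENNReal) :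
    ∫⁻ ρ : unitInterval, f (sel w n (ρ.1 * W)) ≤
      ∑ i ∈ Finset.range n, ENNReal.ofReal (w i / W) * f i := by
  classical
  let A : ℕ → Set unitInterval := fun i => {ρ | ∑ l ∈ Finset.range i, w l ≤ ρ.1 * W ∧
    ρ.1 * W ≤ ∑ l ∈ Finset.range (i + 1), w l}
  have hm : Measurable fun ρ : unitInterval => ρ.1 * W := measurable_subtype_coe.mul_const W
  have hA : ∀ i, MeasurableSet (A i) := fun i =>
    (measurableSet_le measurable_const hm).inter (measurableSet_le hm measurable_const)
  calc ∫⁻ ρ : unitInterval, f (sel w n (ρ.1 * W))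
      ≤ ∫⁻ ρ, ∑ i ∈ Finset.range n, (A i).indicator (fun _ => f i) ρ := by
        refine lintegral_mono fun ρ => ?_
        have h1 : ρ ∈ A (sel w n (ρ.1 * W)) := sel_spec hn ρ.2.1 ρ.2.2 hW hW0.le
        have h2 := Finset.mem_range.2 (sel_lt (w := w) hn (ρ.1 * W))
        refine le_trans ?_ (Finset.single_le_sum
          (f := fun i => (A i).indicator (fun _ => f i) ρ) (fun _ _ => zero_le) h2)
        simp only [Set.indicator_of_mem h1, le_refl]
    _ = ∑ i ∈ Finset.range n, f i * volume (A i) := by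
        rw [lintegral_finsetSum _ fun i _ => measurable_const.indicator (hA i)]
        exact Finset.sum_congr rfl fun i _ => by
          rw [lintegral_indicator_const (hA i)]
    _ ≤ _ := by
        refine Finset.sum_le_sum fun i _ => ?_
        rw [mul_comm]
        refine mul_le_mul_left ((volume_unitInterval_le hW0 _ _).trans_eq ?_) _
        rw [Finset.sum_range_succ, add_sub_cancel_left]

/-! ### Splitting the first random number off from the others. -/

/-- Put a value in front of a sequence. -/
def consSeq {α : Type*} (p : α × (ℕ → α)) : ℕ → α := fun j => Nat.casesOn j p.1 p.2

theorem measurable_consSeq : Measurable (consSeq (α := unitInterval)) := by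
  refine measurable_pi_lambda _ fun j => ?_
  cases j with
  | zero => exact measurable_fst
  | succ j => exact (measurable_pi_apply j).comp measurable_snd

instance : IsProbabilityMeasure RealRAM.coins := by
  unfold RealRAM.coins; infer_instance

/-- The infinite product measure is determined by its values on finite cylinders. Padding a cylinder
with full sides to an initial segment lets the coordinate `0` factor out. This makes it possible to
integrate over one draw at a time. -/
theorem map_consSeq_coins :
    ((volume : Measure unitInterval).prod RealRAM.coins).map consSeq = RealRAM.coins := by
  classical
  refine Measure.eq_infinitePi _ fun S t ht => ?_
  obtain ⟨N, hN⟩ : ∃ N, S ⊆ Finset.range (N + 1) :=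
    ⟨S.sup id, fun i hi => Finset.mem_range.2 (Nat.lt_succ_of_le (Finset.le_sup (f := id) hi))⟩
  let t' : ℕ → Set unitInterval := fun i => if i ∈ S then t i else Set.univ
  have ht' : ∀ i, MeasurableSet (t' i) := fun i => by
    simp only [t']; split_ifs
    exacts [ht i, MeasurableSet.univ]
  have h1 : Set.pi (S : Set ℕ) t = Set.pi (Finset.range (N + 1) : Set ℕ) t' := by
    ext ω
    simp only [Set.mem_pi, Finset.mem_coe, t']
    constructor
    · intro h i _
      split_ifs with hi
      exacts [h i hi, trivial]
    · intro h i hi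
      simpa [hi] using h i (hN hi)
  have h2 : ∏ i ∈ S, volume (t i) = ∏ i ∈ Finset.range (N + 1), volume (t' i) := by
    rw [← Finset.prod_subset hN]
    · exact Finset.prod_congr rfl fun i hi => by simp [t', hi]
    · intro i _ hi
      simp [t', hi]
  have h3 : consSeq ⁻¹' Set.pi (Finset.range (N + 1) : Set ℕ) t' =
      t' 0 ×ˢ Set.pi (Finset.range N : Set ℕ) (fun i => t' (i + 1)) := by
    ext ⟨ρ, ω⟩
    simp only [Set.mem_preimage, Set.mem_pi, Finset.mem_coe, Finset.mem_range, Set.mem_prod]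
    constructor
    · exact fun h => ⟨h 0 (by omega), fun i hi => h (i + 1) (by omega)⟩
    · rintro ⟨h, h'⟩ i hi
      cases i with
      | zero => exact h
      | succ i => exact h' i (by omega)
  rw [h2, h1, Measure.map_apply measurable_consSeq
    (MeasurableSet.pi (Set.to_countable _) fun i _ => ht' i), h3, Measure.prod_prod,
    RealRAM.coins, Measure.infinitePi_pi _ fun i _ => ht' _, Finset.prod_range_succ', mul_comm]

theorem lintegral_coins_consSeq {f : (ℕ → unitInterval) → ENNReal} (hf : Measurable f) :
    ∫⁻ ω, f ω ∂ RealRAM.coins = ∫⁻ ρ : unitInterval, ∫⁻ ω, f (consSeq (ρ, ω)) ∂ RealRAM.coins := by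
  conv_lhs => rw [← map_consSeq_coins]
  rw [lintegral_map hf measurable_consSeq, lintegral_prod (fun p => f (consSeq p)) (hf.comp measurable_consSeq).aemeasurable]

/-! ## Adaptive sampling -/

/-- The squared distances of the points to a flat. -/
noncomputable def residWeight {d : ℕ} (X : ℕ → Pt d) (V : Submodule ℝ (Pt d)) (i : ℕ) : ℝ :=
  Metric.infDist (X i) (V : Set (Pt d)) ^ 2

/-- Add `l` points that are sampled with probabilities proportional to the weights `w` to the flat,
then continue with `next`. -/
noncomputable def sampleRound {d : ℕ} (X : ℕ → Pt d) (n : ℕ) (w : ℕ → ℝ)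
    (next : Submodule ℝ (Pt d) → (ℕ → unitInterval) → Submodule ℝ (Pt d)) :
    ℕ → Submodule ℝ (Pt d) → (ℕ → unitInterval) → Submodule ℝ (Pt d)
  | 0, V, ω => next V ω
  | l + 1, V, ω => sampleRound X n w next l
      (V ⊔ Submodule.span ℝ {X (sel w n ((ω 0).1 * ∑ i ∈ Finset.range n, w i))})
      (fun j => ω (j + 1))

/-- Rounds of `s` samples each, with probabilities proportional to the squared distances to the
flat at the beginning of the round. -/
noncomputable def adaptiveFlat {d : ℕ} (X : ℕ → Pt d) (n s : ℕ) :
    ℕ → Submodule ℝ (Pt d) → (ℕ → unitInterval) → Submodule ℝ (Pt d)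
  | 0, V, _ => V
  | T + 1, V, ω => sampleRound X n (residWeight X V) (adaptiveFlat X n s T) s V ω

theorem le_sampleRound {d : ℕ} {X : ℕ → Pt d} {n : ℕ} {w : ℕ → ℝ}
    {next : Submodule ℝ (Pt d) → (ℕ → unitInterval) → Submodule ℝ (Pt d)}
    (h : ∀ V ω, V ≤ next V ω) (l : ℕ) (V : Submodule ℝ (Pt d)) (ω : ℕ → unitInterval) :
    V ≤ sampleRound X n w next l V ω := by
  induction l generalizing V ω with
  | zero => exact h V ω
  | succ l ih => exact le_sup_left.trans (ih _ _)

theorem le_adaptiveFlat {d : ℕ} {X : ℕ → Pt d} {n s : ℕ} (T : ℕ) (V : Submodule ℝ (Pt d))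
    (ω : ℕ → unitInterval) : V ≤ adaptiveFlat X n s T V ω := by
  induction T generalizing V ω with
  | zero => exact le_rfl
  | succ T ih => exact le_sampleRound ih _ _ _

/-- The flat depends on a draw only through the selected index, so the event is a countable union
over indices. Therefore arbitrary sets and functions of the final flat are admissible and flats need
no σ-algebra. -/
theorem measurableSet_sampleRound {d : ℕ} {X : ℕ → Pt d} {n : ℕ} {w : ℕ → ℝ}
    {next : Submodule ℝ (Pt d) → (ℕ → unitInterval) → Submodule ℝ (Pt d)}
    {S : Set (Submodule ℝ (Pt d))} (h : ∀ V, MeasurableSet {ω | next V ω ∈ S}) (l : ℕ)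
    (V : Submodule ℝ (Pt d)) : MeasurableSet {ω | sampleRound X n w next l V ω ∈ S} := by
  induction l generalizing V with
  | zero => exact h V
  | succ l ih =>
    let W := ∑ i ∈ Finset.range n, w i
    have h1 : {ω | sampleRound X n w next (l + 1) V ω ∈ S} =
        ⋃ i : ℕ, {ω : ℕ → unitInterval | sel w n ((ω 0).1 * W) = i} ∩
          {ω | (fun j => ω (j + 1)) ∈
            {ω | sampleRound X n w next l (V ⊔ Submodule.span ℝ {X i}) ω ∈ S}} := by
      ext ω
      simp [sampleRound, W]
    rw [h1]
    refine MeasurableSet.iUnion fun i => MeasurableSet.inter ?_ ?_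
    · have hm : Measurable fun ω : ℕ → unitInterval => (ω 0).1 * W :=
        (measurable_subtype_coe.comp (measurable_pi_apply 0)).mul_const W
      exact hm (measurableSet_sel_eq w n i)
    · have hm : Measurable fun (ω : ℕ → unitInterval) (j : ℕ) => ω (j + 1) :=
        measurable_pi_lambda _ fun j => measurable_pi_apply (j + 1)
      exact hm (ih _)

theorem measurableSet_adaptiveFlat {d : ℕ} {X : ℕ → Pt d} {n s : ℕ}
    (S : Set (Submodule ℝ (Pt d))) (T : ℕ) (V : Submodule ℝ (Pt d)) :
    MeasurableSet {ω | adaptiveFlat X n s T V ω ∈ S} := by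
  induction T generalizing V with
  | zero => exact MeasurableSet.const (V ∈ S)
  | succ T ih => exact measurableSet_sampleRound ih _ _

theorem lintegral_sampleRound_succ_le {d : ℕ} {X : ℕ → Pt d} {n : ℕ} (hn : 0 < n) {w : ℕ → ℝ}
    {W : ℝ} (hW : W = ∑ i ∈ Finset.range n, w i) (hW0 : 0 < W)
    {next : Submodule ℝ (Pt d) → (ℕ → unitInterval) → Submodule ℝ (Pt d)}
    (hnext : ∀ (S : Set (Submodule ℝ (Pt d))) V, MeasurableSet {ω | next V ω ∈ S}) (h : Submodule ℝ (Pt d) → ENNReal) (l : ℕ)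
    (V : Submodule ℝ (Pt d)) :
    ∫⁻ ω, h (sampleRound X n w next (l + 1) V ω) ∂ RealRAM.coins ≤
      ∑ i ∈ Finset.range n, ENNReal.ofReal (w i / W) *
        ∫⁻ ω, h (sampleRound X n w next l (V ⊔ Submodule.span ℝ {X i}) ω) ∂ RealRAM.coins := by
  have hm : ∀ l V, Measurable fun ω => h (sampleRound X n w next l V ω) := fun l V A _ =>
    measurableSet_sampleRound (S := h ⁻¹' A) (hnext _) l V
  rw [lintegral_coins_consSeq (hm _ _)]
  refine le_trans (le_of_eq ?_) (lintegral_sel_le hn hW hW0 fun i =>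
    ∫⁻ ω, h (sampleRound X n w next l (V ⊔ Submodule.span ℝ {X i}) ω) ∂ RealRAM.coins)
  simp only [sampleRound, hW]
  rfl

/-- The expectation over the rest of a round, in terms of the current estimates `x` of the
combinations `m`. -/
theorem lintegral_sampleRound_le {n d r : ℕ} (hn : 0 < n) {X : ℕ → Pt d}
    {V₀ : Submodule ℝ (Pt d)} {e : Fin n → Pt d} (he : ∀ i : Fin n, IsResid V₀ (X i) (e i))
    {W s : ℝ} (hW : W = ∑ i, ‖e i‖ ^ 2) (hW0 : 0 < W) (hs : 0 < s)
    {u : Fin r → Fin n → ℝ} (hu : ∀ j, ∑ i, u j i ^ 2 = 1)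
    {next : Submodule ℝ (Pt d) → (ℕ → unitInterval) → Submodule ℝ (Pt d)}
    (hnext : ∀ (S : Set (Submodule ℝ (Pt d))) V, MeasurableSet {ω | next V ω ∈ S}) {h : Submodule ℝ (Pt d) → ENNReal}
    {m : Fin r → Pt d} {C : ENNReal}
    (hC : ∀ V, ∀ x : Fin r → Pt d, (∀ j, x j ∈ V) →
      ∫⁻ ω, h (next V ω) ∂ RealRAM.coins ≤ C * ENNReal.ofReal (∑ j, ‖x j - m j‖ ^ 2))
    (l : ℕ) (V : Submodule ℝ (Pt d)) (hV : V₀ ≤ V) (x : Fin r → Pt d) (hx : ∀ j, x j ∈ V) :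
    ∫⁻ ω, h (sampleRound X n (residWeight X V₀) next l V ω) ∂ RealRAM.coins ≤
      C * ENNReal.ofReal (∑ j, ‖x j + (l / s : ℝ) • ∑ i, u j i • e i - m j‖ ^ 2 +
        l * (r * W / s ^ 2)) := by
  have hw : ∀ i : Fin n, residWeight X V₀ i = ‖e i‖ ^ 2 := fun i => by
    rw [residWeight, (he i).infDist_eq]
  have hWw : W = ∑ i ∈ Finset.range n, residWeight X V₀ i := by
    rw [Finset.sum_range, hW]
    exact Finset.sum_congr rfl fun i _ => (hw i).symm
  induction l generalizing V x with
  | zero => simpa [sampleRound] using hC V x hx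
  | succ l ih =>
    refine (lintegral_sampleRound_succ_le hn hWw hW0 hnext h l V).trans ?_
    rw [Finset.sum_range]
    -- The importance-sampling update after drawing `i`. It stays in the enlarged flat because `e i`
    -- differs from `X i` by a vector of `V₀`, the flat at the beginning of the round, which `V`
    -- contains.
    let x' : Fin n → Fin r → Pt d := fun i j => x j + (u j i / (s * (‖e i‖ ^ 2 / W))) • e i
    have hx' : ∀ i : Fin n, ∀ j, x' i j ∈ V ⊔ Submodule.span ℝ {X i} := by
      intro i j
      have h1 : e i = X i - (X i - e i) := by abel
      refine Submodule.add_mem _ (Submodule.mem_sup_left (hx j)) (Submodule.smul_mem _ _ ?_)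
      rw [h1]
      exact Submodule.sub_mem _ (Submodule.mem_sup_right (Submodule.mem_span_singleton_self _))
        (Submodule.mem_sup_left (hV (he i).1))
    -- The mean drift of the remaining `l` draws is credited in advance, so each draw changes the
    -- bound only by its variance, at most `r * W / s ^ 2` in total over the `r` estimates.
    set R : Fin n → ℝ := fun i => ∑ j, ‖x' i j + (l / s : ℝ) • ∑ i, u j i • e i - m j‖ ^ 2 +
      l * (r * W / s ^ 2) with hR
    have hR0 : ∀ i, 0 ≤ R i := fun i => by positivity
    have key : ∑ i, ‖e i‖ ^ 2 / W * R i ≤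
        ∑ j, ‖x j + ((l + 1 : ℕ) / s : ℝ) • ∑ i, u j i • e i - m j‖ ^ 2 +
          (l + 1 : ℕ) * (r * W / s ^ 2) := by
      have hp : ∑ i, ‖e i‖ ^ 2 / W = 1 := by rw [← Finset.sum_div, ← hW, div_self hW0.ne']
      have h1 : ∑ i, ‖e i‖ ^ 2 / W * R i = (∑ j, ∑ i, ‖e i‖ ^ 2 / W *
          ‖(x j + (l / s : ℝ) • ∑ i, u j i • e i - m j) +
            (u j i / (s * (‖e i‖ ^ 2 / W))) • e i‖ ^ 2) + l * (r * W / s ^ 2) := by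
        simp only [hR, mul_add, Finset.sum_add_distrib, ← Finset.sum_mul, hp, one_mul]
        rw [Finset.sum_comm]
        congr 1
        refine Finset.sum_congr rfl fun i _ => ?_
        rw [Finset.mul_sum]
        refine Finset.sum_congr rfl fun j _ => ?_
        congr 3
        simp only [x']
        abel
      rw [h1]
      have h2 := Finset.sum_le_sum fun (j : Fin r) (_ : j ∈ Finset.univ) =>
        sum_prob_estimator_le hW hW0 hs (hu j) (x j + (l / s : ℝ) • ∑ i, u j i • e i - m j)
      rw [Finset.sum_add_distrib] at h2
      have h3 : ∀ j, x j + (l / s : ℝ) • ∑ i, u j i • e i - m j + (1 / s) • ∑ i, u j i • e i =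
          x j + ((l + 1 : ℕ) / s : ℝ) • ∑ i, u j i • e i - m j := by
        intro j
        push_cast
        rw [add_div, add_smul]
        abel
      simp only [h3] at h2
      have h4 : ∑ _j : Fin r, W / s ^ 2 = r * W / s ^ 2 := by simp; ring
      rw [h4] at h2
      push_cast at h2 ⊢
      linarith
    calc ∑ i : Fin n, ENNReal.ofReal (residWeight X V₀ i / W) *
          ∫⁻ ω, h (sampleRound X n (residWeight X V₀) next l (V ⊔ Submodule.span ℝ {X i}) ω)
            ∂ RealRAM.coins
        ≤ ∑ i : Fin n, C * ENNReal.ofReal (‖e i‖ ^ 2 / W * R i) := by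
          refine Finset.sum_le_sum fun i _ => ?_
          rw [hw, ENNReal.ofReal_mul (by positivity), mul_left_comm]
          exact mul_le_mul_right (ih _ (hV.trans le_sup_left) (x' i) (hx' i)) _
      _ = C * ENNReal.ofReal (∑ i, ‖e i‖ ^ 2 / W * R i) := by
          rw [ENNReal.ofReal_sum_of_nonneg fun i _ => mul_nonneg (by positivity) (hR0 i),
            Finset.mul_sum]
      _ ≤ _ := mul_le_mul_right (ENNReal.ofReal_le_ofReal key) _

/-! ### The potential of a flat and its decay under sampling. -/

/-- Every flat of dimension at most `k` inside `V` is more expensive than `(1 + ε)` times the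
optimal price. -/
def IsBad {n d : ℕ} (P : Fin n → Pt d) (k : ℕ) (ε : ℝ) (V : Submodule ℝ (Pt d)) : Prop :=
  ∀ G ≤ V, Module.finrank ℝ G ≤ k → (1 + ε) * optPrice P k < price P G

theorem IsBad.anti {n d k : ℕ} {P : Fin n → Pt d} {ε : ℝ} {V V' : Submodule ℝ (Pt d)}
    (h : IsBad P k ε V') (hV : V ≤ V') : IsBad P k ε V := fun G hG => h G (hG.trans hV)

open Classical in
/-- The price of the best flat of dimension at most `k` inside `V` if `V` is bad, and zero
otherwise. -/
noncomputable def badPrice {n d : ℕ} (P : Fin n → Pt d) (k : ℕ) (ε : ℝ)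
    (V : Submodule ℝ (Pt d)) : ENNReal :=
  if IsBad P k ε V then
    ⨅ G : {G : Submodule ℝ (Pt d) // G ≤ V ∧ Module.finrank ℝ G ≤ k}, ENNReal.ofReal (price P G.1)
  else 0

theorem badPrice_anti {n d k : ℕ} {P : Fin n → Pt d} {ε : ℝ} {V V' : Submodule ℝ (Pt d)}
    (hV : V ≤ V') : badPrice P k ε V' ≤ badPrice P k ε V := by
  unfold badPrice
  by_cases h' : IsBad P k ε V'
  · rw [if_pos h', if_pos (h'.anti hV)]
    exact le_iInf fun G => iInf_le_of_le ⟨G.1, G.2.1.trans hV, G.2.2⟩ le_rfl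
  · rw [if_neg h']; exact zero_le

theorem ofReal_price_le_badPrice {n d k : ℕ} {P : Fin n → Pt d} {ε : ℝ}
    {V : Submodule ℝ (Pt d)} (h : IsBad P k ε V) : ENNReal.ofReal (price P V) ≤ badPrice P k ε V := by
  rw [badPrice, if_pos h]
  exact le_iInf fun G => ENNReal.ofReal_le_ofReal (price_anti P G.2.1)

theorem ofReal_optPrice_le_badPrice {n d k : ℕ} {P : Fin n → Pt d} {ε : ℝ} (hk : k ≤ d)
    {V : Submodule ℝ (Pt d)} (h : IsBad P k ε V) :
    ENNReal.ofReal (optPrice P k) ≤ badPrice P k ε V := by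
  rw [badPrice, if_pos h]
  obtain ⟨G, -, -, hopt⟩ := exists_price_eq_optPrice P hk
  exact le_iInf fun G => ENNReal.ofReal_le_ofReal (hopt _ G.2.2)

/-- If `V` is bad, the excess `D` exceeds `ε` times the optimum, so the optimum itself is at most `D
/ ε`. This removes the optimum from the bound, which is what lets the potential decay geometrically.
-/
theorem badPrice_le {n d k : ℕ} {P : Fin n → Pt d} {ε D : ℝ} (hε : 0 < ε)
    {V G : Submodule ℝ (Pt d)} (hG : G ≤ V) (hGk : Module.finrank ℝ G ≤ k)
    (hD : price P G ≤ optPrice P k + D) :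
    badPrice P k ε V ≤ ENNReal.ofReal (1 + 1 / ε) * ENNReal.ofReal D := by
  rw [badPrice]
  split_ifs with h
  · rw [← ENNReal.ofReal_mul (by positivity)]
    refine (iInf_le _ ⟨G, hG, hGk⟩).trans (ENNReal.ofReal_le_ofReal ?_)
    have h1 := h G hG hGk
    have h2 : optPrice P k ≤ D / ε := by
      rw [le_div_iff₀ hε]; linarith
    calc price P G ≤ optPrice P k + D := hD
      _ ≤ D / ε + D := by linarith
      _ = _ := by ring
  · exact zero_le

/-- Such a `V` contains all points, hence also the exact combinations `∑ i, u j i • P i`, and these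
span a flat of at most the optimal price. -/
theorem not_isBad_of_price_eq_zero {n d k : ℕ} {P : Fin n → Pt d} {ε : ℝ} (hε : 0 < ε)
    (hk : k ≤ d) {V : Submodule ℝ (Pt d)} (hV : price P V = 0) : ¬ IsBad P k ε V := by
  intro h
  obtain ⟨m, hm, u, -, hw⟩ := exists_coeff P hk
  have hmem : ∀ i, P i ∈ V := by
    rw [price_eq_of_isResid fun i => isResid_proj V (P i),
      Finset.sum_eq_zero_iff_of_nonneg fun _ _ => sq_nonneg _] at hV
    intro i
    have := hV i (Finset.mem_univ i)
    exact (isResid_proj V (P i)).mem_of_eq_zero (norm_eq_zero.1 (pow_eq_zero_iff two_ne_zero |>.1 this))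
  have h1 := hw fun j => ∑ i, u j i • P i
  have h2 := h (Submodule.span ℝ (Set.range fun j => ∑ i, u j i • P i))
    (Submodule.span_le.2 (by
      rintro _ ⟨j, rfl⟩
      exact Submodule.sum_mem _ fun i _ => Submodule.smul_mem _ _ (hmem i)))
    ((finrank_range_le_card (R := ℝ) fun j => ∑ i, u j i • P i).trans (by simpa using hm))
  have h3 : 0 ≤ optPrice P k := Real.iInf_nonneg fun G => price_nonneg _ _
  simp only [sub_self, norm_zero] at h1
  norm_num at h1
  nlinarith

/-- The bound uses the price of `V` itself, not its potential. The first round can therefore start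
from the given flat, whose price is controlled although the best flat of dimension at most `k`
inside it need not be cheap. -/
theorem lintegral_badPrice_round {n d k s T : ℕ} (hn : 0 < n) (hk : k ≤ d)
    {P : Fin n → Pt d} {X : ℕ → Pt d} (hX : ∀ i : Fin n, X i = P i) {ε : ℝ} (hε : 0 < ε)
    (hε1 : ε ≤ 1) (hs0 : 0 < s) (hs : 4 * k ≤ s * ε) {β : ENNReal}
    (hT : ∀ V, ∫⁻ ω, badPrice P k ε (adaptiveFlat X n s T V ω) ∂ RealRAM.coins ≤
      β * badPrice P k ε V) (V : Submodule ℝ (Pt d)) :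
    ∫⁻ ω, badPrice P k ε (adaptiveFlat X n s (T + 1) V ω) ∂ RealRAM.coins ≤
      β * 2⁻¹ * ENNReal.ofReal (price P V) := by
  -- With price zero all sampling weights vanish and the estimates are unavailable, but then `V` is
  -- already good.
  rcases (price_nonneg P V).eq_or_lt with h0 | h0
  · have hV : badPrice P k ε V = 0 := by
      rw [badPrice, if_neg (not_isBad_of_price_eq_zero hε hk h0.symm)]
    have : ∀ ω, badPrice P k ε (adaptiveFlat X n s (T + 1) V ω) = 0 := fun ω =>
      le_antisymm (hV ▸ badPrice_anti (le_adaptiveFlat _ _ _)) zero_le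
    simp [this]
  obtain ⟨m, hm, u, hu, hw⟩ := exists_coeff P hk
  set e : Fin n → Pt d := fun i => P i - V.starProjection (P i) with he_def
  have he : ∀ i : Fin n, IsResid V (X i) (e i) := fun i => by
    rw [hX]; exact isResid_proj V (P i)
  have hprice : price P V = ∑ i, ‖e i‖ ^ 2 := price_eq_of_isResid fun i => isResid_proj V (P i)
  have hs' : (0 : ℝ) < s := by exact_mod_cast hs0
  have main := lintegral_sampleRound_le (r := m) (C := β * ENNReal.ofReal (1 + 1 / ε)) hn he hprice
    h0 hs' hu (next := adaptiveFlat X n s T) (fun S V => measurableSet_adaptiveFlat S T V)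
    (h := badPrice P k ε) (m := fun j => ∑ i, u j i • P i) (fun V' x hx => by
      refine (hT V').trans ?_
      rw [mul_assoc]
      exact mul_le_mul_right (badPrice_le hε (G := Submodule.span ℝ (Set.range x))
        (Submodule.span_le.2 (by rintro _ ⟨j, rfl⟩; exact hx j))
        ((finrank_range_le_card (R := ℝ) x).trans (by simpa using hm)) (hw x)) _)
    -- The estimates start at the parts of the combinations that lie in `V`; `s` draws add the
    -- residual parts in the mean, so the bias is zero (`h3`) and only variance remains.
    s V le_rfl (fun j => ∑ i, u j i • V.starProjection (P i))
    (fun j => Submodule.sum_mem _ fun i _ => Submodule.smul_mem _ _ (by simp))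
  refine main.trans ?_
  rw [mul_assoc, mul_assoc, ← ENNReal.ofReal_mul (by positivity)]
  refine mul_le_mul_right ?_ _
  have h2 : (2⁻¹ : ENNReal) = ENNReal.ofReal (2⁻¹) := by
    rw [ENNReal.ofReal_inv_of_pos two_pos]; norm_num
  rw [h2, ← ENNReal.ofReal_mul (by positivity)]
  refine ENNReal.ofReal_le_ofReal ?_
  have h3 : ∀ j, ∑ i, u j i • V.starProjection (P i) + ((s : ℝ) / s) • ∑ i, u j i • e i -
      ∑ i, u j i • P i = 0 := by
    intro j
    rw [div_self hs'.ne', one_smul, ← Finset.sum_add_distrib, ← Finset.sum_sub_distrib]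
    exact Finset.sum_eq_zero fun i _ => by rw [← smul_add, ← smul_sub]; simp [he_def]
  simp only [h3, norm_zero]
  have hmk : (m : ℝ) ≤ k := by exact_mod_cast hm
  -- The factor is at most `2 * k / (4 * k)`, from `ε ≤ 1`, `m ≤ k` and `4 * k ≤ s * ε`.
  have e1 : (1 + 1 / ε) * (∑ _j : Fin m, (0 : ℝ) ^ 2 + s * (m * price P V / (s : ℝ) ^ 2)) =
      (ε + 1) * m / (s * ε) * price P V := by
    simp
    field_simp
  rw [e1]
  refine mul_le_mul_of_nonneg_right ?_ h0.le
  rw [div_le_iff₀ (by positivity)]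
  nlinarith

theorem lintegral_badPrice_adaptiveFlat {n d k s : ℕ} (hn : 0 < n) (hk : k ≤ d)
    {P : Fin n → Pt d} {X : ℕ → Pt d} (hX : ∀ i : Fin n, X i = P i) {ε : ℝ} (hε : 0 < ε)
    (hε1 : ε ≤ 1) (hs0 : 0 < s) (hs : 4 * k ≤ s * ε) (T : ℕ) (V : Submodule ℝ (Pt d)) :
    ∫⁻ ω, badPrice P k ε (adaptiveFlat X n s T V ω) ∂ RealRAM.coins ≤
      2⁻¹ ^ T * badPrice P k ε V := by
  induction T generalizing V with
  | zero => simp [adaptiveFlat]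
  | succ T ih =>
    by_cases h : IsBad P k ε V
    · refine (lintegral_badPrice_round hn hk hX hε hε1 hs0 hs ih V).trans ?_
      rw [pow_succ]
      exact mul_le_mul_right (ofReal_price_le_badPrice h) _
    · have hV : badPrice P k ε V = 0 := by rw [badPrice, if_neg h]
      have : ∀ ω, badPrice P k ε (adaptiveFlat X n s (T + 1) V ω) = 0 := fun ω =>
        le_antisymm (hV ▸ badPrice_anti (le_adaptiveFlat _ _ _)) zero_le
      simp [this]

/-- The probability that adaptive sampling fails. -/
theorem coins_isBad_adaptiveFlat_le {n d k s T : ℕ} (hn : 0 < n) (hk : k ≤ d)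
    {P : Fin n → Pt d} {X : ℕ → Pt d} (hX : ∀ i : Fin n, X i = P i) {ε δ c : ℝ} (hε : 0 < ε)
    (hε1 : ε ≤ 1) (hs0 : 0 < s) (hs : 4 * k ≤ s * ε) (hT : c ≤ 2 ^ T * δ) (hT0 : 0 < T)
    {V : Submodule ℝ (Pt d)} (hV : price P V ≤ c * optPrice P k) :
    RealRAM.coins {ω | IsBad P k ε (adaptiveFlat X n s T V ω)} ≤ ENNReal.ofReal δ := by
  have hopt : 0 ≤ optPrice P k := Real.iInf_nonneg fun G => price_nonneg _ _
  -- Markov's inequality at the level of the optimum needs a positive optimum; if it is zero, the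
  -- given flat already contains all points.
  rcases hopt.eq_or_lt with h0 | h0
  · have hV0 : price P V = 0 := le_antisymm (by simpa [← h0] using hV) (price_nonneg _ _)
    have : {ω | IsBad P k ε (adaptiveFlat X n s T V ω)} = ∅ := by
      ext ω
      simp only [Set.mem_ofPred_eq, Set.mem_empty_iff_false, iff_false]
      exact fun h => not_isBad_of_price_eq_zero hε hk hV0 (h.anti (le_adaptiveFlat _ _ _))
    simp [this]
  -- One round is set aside to pass from the price of the given flat to the potential; the others
  -- halve the potential.
  obtain ⟨T, rfl⟩ : ∃ T', T = T' + 1 := ⟨T - 1, by omega⟩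
  have h1 := lintegral_badPrice_round hn hk hX hε hε1 hs0 hs
    (lintegral_badPrice_adaptiveFlat hn hk hX hε hε1 hs0 hs T) V
  rw [← pow_succ] at h1
  have hm : Measurable fun ω => badPrice P k ε (adaptiveFlat X n s (T + 1) V ω) := fun A _ =>
    measurableSet_adaptiveFlat (badPrice P k ε ⁻¹' A) _ V
  have h2 := mul_meas_ge_le_lintegral (μ := RealRAM.coins) hm (ENNReal.ofReal (optPrice P k))
  have h3 : RealRAM.coins {ω | IsBad P k ε (adaptiveFlat X n s (T + 1) V ω)} ≤ RealRAM.coins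
      {ω | ENNReal.ofReal (optPrice P k) ≤ badPrice P k ε (adaptiveFlat X n s (T + 1) V ω)} :=
    measure_mono fun ω h => ofReal_optPrice_le_badPrice hk h
  have h4 : ENNReal.ofReal (optPrice P k) ≠ 0 := by simpa using h0
  refine h3.trans ?_
  rw [← ENNReal.mul_le_mul_iff_right h4 ENNReal.ofReal_ne_top]
  refine (h2.trans h1).trans ?_
  have h5 : (2⁻¹ : ENNReal) = ENNReal.ofReal (2⁻¹) := by
    rw [ENNReal.ofReal_inv_of_pos two_pos]; norm_num
  rw [h5, ← ENNReal.ofReal_pow (by positivity), ← ENNReal.ofReal_mul (by positivity),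
    ← ENNReal.ofReal_mul h0.le]
  refine ENNReal.ofReal_le_ofReal ?_
  rw [inv_pow, inv_mul_le_iff₀ (by positivity)]
  calc price P V ≤ c * optPrice P k := hV
    _ ≤ (2 ^ (T + 1) * δ) * optPrice P k := mul_le_mul_of_nonneg_right hT h0.le
    _ = _ := by ring

namespace RealRAM

/-! ## Reasoning about programs -/

/-- Whether a program has an assignment to the natural register `x`. -/
def Cmd.setsN (x : ℕ) : Cmd → Bool
  | .nset y _ => x == y
  | .seq c c' | .ite _ c c' => c.setsN x || c'.setsN x
  | .loop _ c => c.setsN x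
  | _ => false

/-- Whether a program has an assignment to the real register `x`. -/
def Cmd.setsR (x : ℕ) : Cmd → Bool
  | .rset y _ | .rand y => x == y
  | .seq c c' | .ite _ c c' => c.setsR x || c'.setsR x
  | .loop _ c => c.setsR x
  | _ => false

/-- Whether a program writes into the real array `x`. -/
def Cmd.setsA (x : ℕ) : Cmd → Bool
  | .rput y _ _ | .svd _ _ _ y => x == y
  | .seq c c' | .ite _ c c' => c.setsA x || c'.setsA x
  | .loop _ c => c.setsA x
  | _ => false

/-- Whether a program draws random numbers. -/
def Cmd.draws : Cmd → Bool
  | .rand _ => true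
  | .seq c c' | .ite _ c c' => c.draws || c'.draws
  | .loop _ c => c.draws
  | _ => false

/-- The states agree wherever the program `c` does not write. -/
structure Agree (c : Cmd) (s s' : State) : Prop where
  n : ∀ x, c.setsN x = false → s'.nreg x = s.nreg x
  r : ∀ x, c.setsR x = false → s'.rreg x = s.rreg x
  a : ∀ x, c.setsA x = false → s'.rarr x = s.rarr x
  p : c.draws = false → s'.pos = s.pos

theorem Agree.refl (c : Cmd) (s : State) : Agree c s s :=
  ⟨fun _ _ => rfl, fun _ _ => rfl, fun _ _ => rfl, fun _ => rfl⟩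

theorem Agree.trans {c : Cmd} {s s' s'' : State} (h : Agree c s s') (h' : Agree c s' s'') :
    Agree c s s'' :=
  ⟨fun x hx => (h'.n x hx).trans (h.n x hx), fun x hx => (h'.r x hx).trans (h.r x hx),
    fun x hx => (h'.a x hx).trans (h.a x hx), fun hx => (h'.p hx).trans (h.p hx)⟩

/-- `c'` writes at most where `c` does. -/
structure Within (c' c : Cmd) : Prop where
  n : ∀ x, c.setsN x = false → c'.setsN x = false
  r : ∀ x, c.setsR x = false → c'.setsR x = false
  a : ∀ x, c.setsA x = false → c'.setsA x = false
  p : c.draws = false → c'.draws = false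

theorem Agree.within {c c' : Cmd} {s s' : State} (h : Agree c' s s') (hc : Within c' c) :
    Agree c s s' :=
  ⟨fun x hx => h.n x (hc.n x hx), fun x hx => h.r x (hc.r x hx), fun x hx => h.a x (hc.a x hx),
    fun hx => h.p (hc.p hx)⟩

theorem Within.seq_left (c c' : Cmd) : Within c (.seq c c') := by
  constructor <;> simp [Cmd.setsN, Cmd.setsR, Cmd.setsA, Cmd.draws] <;> tauto

theorem Within.seq_right (c c' : Cmd) : Within c' (.seq c c') := by
  constructor <;> simp [Cmd.setsN, Cmd.setsR, Cmd.setsA, Cmd.draws]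

theorem Within.loop (b : BExp) (c : Cmd) : Within c (.loop b c) :=
  ⟨fun _ => id, fun _ => id, fun _ => id, id⟩

theorem Within.trans {c c' c'' : Cmd} (h : Within c c') (h' : Within c' c'') : Within c c'' :=
  ⟨fun x hx => h.n x (h'.n x hx), fun x hx => h.r x (h'.r x hx), fun x hx => h.a x (h'.a x hx),
    fun hx => h.p (h'.p hx)⟩

/-- The frame rule. The write sets are computed Booleans, so for a concrete program the side
conditions hold by `rfl`. -/
theorem Exec.agree {ω : ℕ → unitInterval} {c : Cmd} {s s' : State} {t : ℕ}
    (h : Exec ω c s t s') : Agree c s s' := by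
  induction h with
  | skip s => exact Agree.refl _ _
  | nset s x e =>
    refine ⟨fun y hy => ?_, fun _ _ => rfl, fun _ _ => rfl, fun _ => rfl⟩
    exact Function.update_of_ne (by simpa [Cmd.setsN] using hy) _ _
  | rset s x e =>
    refine ⟨fun _ _ => rfl, fun y hy => ?_, fun _ _ => rfl, fun _ => rfl⟩
    exact Function.update_of_ne (by simpa [Cmd.setsR] using hy) _ _
  | nput s a i e => exact ⟨fun _ _ => rfl, fun _ _ => rfl, fun _ _ => rfl, fun _ => rfl⟩
  | rput s a i e =>
    refine ⟨fun _ _ => rfl, fun _ _ => rfl, fun y hy => ?_, fun _ => rfl⟩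
    exact Function.update_of_ne (by simpa [Cmd.setsA] using hy) _ _
  | rand s x =>
    refine ⟨fun _ _ => rfl, fun y hy => ?_, fun _ _ => rfl, fun h => by simp [Cmd.draws] at h⟩
    exact Function.update_of_ne (by simpa [Cmd.setsR] using hy) _ _
  | svd s p q src dst =>
    refine ⟨fun _ _ => rfl, fun _ _ => rfl, fun y hy => ?_, fun _ => rfl⟩
    exact Function.update_of_ne (by simpa [Cmd.setsA] using hy) _ _
  | seq _ _ ih ih' =>
    exact (ih.within (Within.seq_left _ _)).trans (ih'.within (Within.seq_right _ _))
  | @iteTrue _ _ b c c' _ _ _ ih =>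
    have := ih.within (Within.seq_left c c')
    exact ⟨this.n, this.r, this.a, this.p⟩
  | @iteFalse _ _ b c c' _ _ _ ih =>
    have := ih.within (Within.seq_right c c')
    exact ⟨this.n, this.r, this.a, this.p⟩
  | loopDone _ => exact Agree.refl _ _
  | loopStep _ _ _ ih ih' => exact (ih.within (Within.loop _ _)).trans ih'

/-- The program `c`, started in `s`, halts within `t` steps in a state with the property `Q`. -/
def Runs (ω : ℕ → unitInterval) (c : Cmd) (s : State) (t : ℕ) (Q : State → Prop) : Prop :=
  ∃ t' s', t' ≤ t ∧ Exec ω c s t' s' ∧ Q s'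

variable {ω : ℕ → unitInterval}

theorem Runs.mono {c : Cmd} {s : State} {t t' : ℕ} {Q Q' : State → Prop} (h : Runs ω c s t Q)
    (ht : t ≤ t') (hQ : ∀ s', Agree c s s' → Q s' → Q' s') : Runs ω c s t' Q' := by
  obtain ⟨t₁, s', h1, h2, h3⟩ := h
  exact ⟨t₁, s', h1.trans ht, h2, hQ s' h2.agree h3⟩

theorem Runs.seq {c c' : Cmd} {s : State} {t t' : ℕ} {Q Q' : State → Prop} (h : Runs ω c s t Q)
    (h' : ∀ s', Agree c s s' → Q s' → Runs ω c' s' t' Q') : Runs ω (.seq c c') s (t + t') Q' := by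
  obtain ⟨t₁, s', h1, h2, h3⟩ := h
  obtain ⟨t₂, s'', h1', h2', h3'⟩ := h' s' h2.agree h3
  exact ⟨_, s'', Nat.add_le_add h1 h1', h2.seq h2', h3'⟩

theorem Runs.skip {s : State} {Q : State → Prop} (h : Q s) : Runs ω .skip s 1 Q :=
  ⟨_, _, le_rfl, .skip s, h⟩

theorem Runs.nset {s : State} {x : ℕ} {e : NExp} {Q : State → Prop}
    (h : Q { s with nreg := Function.update s.nreg x (e.eval s) }) :
    Runs ω (.nset x e) s (e.cost + 1) Q :=
  ⟨_, _, le_rfl, .nset s x e, h⟩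

theorem Runs.rset {s : State} {x : ℕ} {e : RExp} {Q : State → Prop}
    (h : Q { s with rreg := Function.update s.rreg x (e.eval s) }) :
    Runs ω (.rset x e) s (e.cost + 1) Q :=
  ⟨_, _, le_rfl, .rset s x e, h⟩

theorem Runs.rput {s : State} {a : ℕ} {i : NExp} {e : RExp} {Q : State → Prop}
    (h : Q { s with rarr := Function.update s.rarr a
                      (Function.update (s.rarr a) (i.eval s) (e.eval s)) }) :
    Runs ω (.rput a i e) s (i.cost + e.cost + 1) Q :=
  ⟨_, _, le_rfl, .rput s a i e, h⟩

theorem Runs.rand {s : State} {x : ℕ} {Q : State → Prop}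
    (h : Q { s with rreg := Function.update s.rreg x (ω s.pos : ℝ), pos := s.pos + 1 }) :
    Runs ω (.rand x) s 1 Q :=
  ⟨_, _, le_rfl, .rand s x, h⟩

theorem Runs.svd {s : State} {p q : NExp} {src dst : ℕ} {Q : State → Prop}
    (h : Q { s with rarr := Function.update s.rarr dst
                      (writeMatrix
                        (Matrix.of fun i j =>
                          rightSingularBasis (readMatrix (s.rarr src) (p.eval s) (q.eval s)) i j)
                        (s.rarr dst)) }) :
    Runs ω (.svd p q src dst) s (p.cost + q.cost + (p.eval s + q.eval s) * q.eval s ^ 2 + 1) Q :=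
  ⟨_, _, le_rfl, .svd s p q src dst, h⟩

theorem Runs.ite {b : BExp} {c c' : Cmd} {s : State} {t : ℕ} {Q : State → Prop}
    (h : b.holds s → Runs ω c s t Q) (h' : ¬ b.holds s → Runs ω c' s t Q) :
    Runs ω (.ite b c c') s (b.cost + t + 1) Q := by
  by_cases hb : b.holds s
  · obtain ⟨t₁, s', h1, h2, h3⟩ := h hb
    exact ⟨_, s', by omega, .iteTrue hb h2, h3⟩
  · obtain ⟨t₁, s', h1, h2, h3⟩ := h' hb
    exact ⟨_, s', by omega, .iteFalse hb h2, h3⟩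

/-- Indexing the invariant by the iteration number gives termination after exactly `N` passes and
the step bound together. The frame `Agree (.loop b c) s s'` reaches back to the start, so untouched
registers need not be part of `J`. -/
theorem Runs.loop {b : BExp} {c : Cmd} {s : State} {N T : ℕ} (J : ℕ → State → Prop)
    (h0 : J 0 s)
    (hstep : ∀ t < N, ∀ s', Agree (.loop b c) s s' → J t s' →
      b.holds s' ∧ Runs ω c s' T (J (t + 1)))
    (hend : ∀ s', Agree (.loop b c) s s' → J N s' → ¬ b.holds s') :
    Runs ω (.loop b c) s (N * (b.cost + T + 1) + b.cost + 1) (J N) := by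
  suffices H : ∀ m t s', m + t = N → Agree (.loop b c) s s' → J t s' →
      Runs ω (.loop b c) s' (m * (b.cost + T + 1) + b.cost + 1) (J N) from
    H N 0 s (by omega) (Agree.refl _ _) h0
  intro m
  induction m with
  | zero =>
    intro t s' ht ha hJ
    obtain rfl : t = N := by omega
    exact ⟨_, s', by omega, .loopDone (hend s' ha hJ), hJ⟩
  | succ m ih =>
    intro t s' ht ha hJ
    obtain ⟨hb, t₁, s₁, h1, h2, h3⟩ := hstep t (by omega) s' ha hJ
    obtain ⟨t₂, s₂, h4, h5, h6⟩ := ih (t + 1) s₁ (by omega)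
      (ha.trans (h2.agree.within (Within.loop _ _))) h3
    refine ⟨_, s₂, ?_, .loopStep hb h2 h5, h6⟩
    rw [Nat.succ_mul]
    omega

/-- Run `body` for the values `0, …, len - 1` of the natural register `i`. -/
def forLoop (i : ℕ) (len : NExp) (body : Cmd) : Cmd :=
  .seq (.nset i (.lit 0))
    (.loop (.nlt (.reg i) len) (.seq body (.nset i (.add (.reg i) (.lit 1)))))

theorem Within.forLoop (i : ℕ) (len : NExp) (body : Cmd) : Within body (forLoop i len body) :=
  (Within.seq_left _ _).trans ((Within.loop _ _).trans (Within.seq_right _ _))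

theorem Runs.forLoop {i : ℕ} {len : NExp} {body : Cmd} {s : State} {N T : ℕ}
    (J : ℕ → State → Prop) (hi : body.setsN i = false)
    (hlen : ∀ s', Agree (forLoop i len body) s s' → len.eval s' = N)
    (h0 : J 0 { s with nreg := Function.update s.nreg i 0 })
    (hstep : ∀ t < N, ∀ s', Agree (RealRAM.forLoop i len body) s s' → s'.nreg i = t → J t s' →
      Runs ω body s' T (fun s'' => J (t + 1) { s'' with nreg := Function.update s''.nreg i (t + 1) })) :
    Runs ω (RealRAM.forLoop i len body) s (N * (T + len.cost + 7) + len.cost + 5) (J N) := by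
  have hset : ∀ v, Agree (RealRAM.forLoop i len body) s { s with nreg := Function.update s.nreg i v } := by
    intro v
    refine ⟨fun y hy => ?_, fun _ _ => rfl, fun _ _ => rfl, fun _ => rfl⟩
    refine Function.update_of_ne ?_ _ _
    rintro rfl
    simp [RealRAM.forLoop, Cmd.setsN] at hy
  refine Runs.mono (Runs.seq (Q := fun s' => J 0 s' ∧ s'.nreg i = 0 ∧ Agree (RealRAM.forLoop i len body) s s')
    (Runs.nset ⟨h0, by simp [NExp.eval], hset 0⟩) fun s₁ _ h1 =>
    Runs.loop (T := T + 4) (N := N)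
      (fun t s' => J t s' ∧ s'.nreg i = t ∧ Agree (RealRAM.forLoop i len body) s s') h1
      (fun t ht s' _ hJ => ⟨?_, ?_⟩) fun s' _ hJ => ?_) ?_ fun _ _ h => h.1
  · simp only [BExp.holds, NExp.eval, hJ.2.1, hlen s' hJ.2.2]
    exact ht
  · refine Runs.seq (hstep t ht s' hJ.2.2 hJ.2.1 hJ.1) fun s₂ ha hJ2 => Runs.nset (e := .add (.reg i) (.lit 1)) ?_
    have hv : s₂.nreg i = t := (ha.n i hi).trans hJ.2.1
    simp only [NExp.eval, hv]
    refine ⟨hJ2, by simp, hJ.2.2.trans ((ha.within (Within.forLoop _ _ _)).trans ?_)⟩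
    refine ⟨fun y hy => ?_, fun _ _ => rfl, fun _ _ => rfl, fun _ => rfl⟩
    refine Function.update_of_ne ?_ _ _
    rintro rfl
    simp [RealRAM.forLoop, Cmd.setsN] at hy
  · simp only [BExp.holds, NExp.eval, hJ.2.1, hlen s' hJ.2.2]
    omega
  · simp only [BExp.cost, NExp.cost]
    apply le_of_eq
    ring

/-- Put the sum of the values of `e` over `0, …, len - 1` for the register `i` into the real
register `x`. -/
def sumLoop (x i : ℕ) (len : NExp) (e : RExp) : Cmd :=
  .seq (.rset x (.ofNat (.lit 0))) (forLoop i len (.rset x (.add (.reg x) e)))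

theorem Runs.sumLoop {x i : ℕ} {len : NExp} {e : RExp} {s : State} {N : ℕ} {f : ℕ → ℝ}
    (hlen : ∀ s', Agree (sumLoop x i len e) s s' → len.eval s' = N)
    (he : ∀ t < N, ∀ s', Agree (RealRAM.sumLoop x i len e) s s' → s'.nreg i = t → e.eval s' = f t) :
    Runs ω (RealRAM.sumLoop x i len e) s (N * (e.cost + len.cost + 10) + len.cost + 8)
      (fun s' => s'.rreg x = ∑ t ∈ Finset.range N, f t) := by
  refine Runs.mono (Runs.seq (Q := fun s' => s'.rreg x = 0) (Runs.rset (by simp [RExp.eval, NExp.eval]))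
    fun s₁ h1 hx => Runs.forLoop (N := N) (T := e.cost + 3)
      (fun t s' => s'.rreg x = ∑ t ∈ Finset.range t, f t) rfl (fun s' ha => hlen s' ?_) ?_
      (fun t ht s' ha hi hJ => Runs.mono (Runs.rset (e := .add (.reg x) e) ?_) ?_ fun _ _ h => h))
    ?_ fun _ _ h => h
  · exact (h1.within (Within.seq_left _ _)).trans (ha.within (Within.seq_right _ _))
  · simpa using hx
  · simp only [RExp.eval, Function.update_self, hJ, Finset.sum_range_succ]
    rw [he t ht s' ((h1.within (Within.seq_left _ _)).trans (ha.within (Within.seq_right _ _))) hi]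
  · simp only [RExp.cost]; omega
  · simp only [RExp.cost, NExp.cost]
    apply le_of_eq
    ring

/-- Fill a segment of the real array `a` with the values of `e` for `0, …, len - 1`. -/
def fillLoop (i : ℕ) (len : NExp) (a : ℕ) (idx : NExp) (e : RExp) : Cmd :=
  forLoop i len (.rput a idx e)

/-- The values may be read from the array that is being overwritten. Hence `he` may assume that all
entries outside the part written so far are still the original ones. -/
theorem Runs.fillLoop {i : ℕ} {len : NExp} {a : ℕ} {idx : NExp} {e : RExp} {s : State}
    {N o : ℕ} {f : ℕ → ℝ}
    (hlen : ∀ s', Agree (fillLoop i len a idx e) s s' → len.eval s' = N)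
    (he : ∀ t < N, ∀ s', Agree (RealRAM.fillLoop i len a idx e) s s' → s'.nreg i = t →
      (∀ j, j < o ∨ o + t ≤ j → s'.rarr a j = s.rarr a j) → idx.eval s' = o + t ∧ e.eval s' = f t) :
    Runs ω (RealRAM.fillLoop i len a idx e) s
      (N * (idx.cost + e.cost + len.cost + 8) + len.cost + 5)
      (fun s' => (∀ t < N, s'.rarr a (o + t) = f t) ∧
        ∀ j, j < o ∨ o + N ≤ j → s'.rarr a j = s.rarr a j) := by
  refine Runs.mono (Runs.forLoop (N := N) (T := idx.cost + e.cost + 1)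
    (fun t s' => (∀ t' < t, s'.rarr a (o + t') = f t') ∧
        ∀ j, j < o ∨ o + t ≤ j → s'.rarr a j = s.rarr a j) rfl hlen (by simp)
    (fun t ht s' ha hi hJ => Runs.rput ?_)) ?_ fun _ _ h => h
  · obtain ⟨h1, h2⟩ := he t ht s' ha hi hJ.2
    simp only [h1, h2, Function.update_self]
    constructor
    · intro t' ht'
      rcases eq_or_ne t' t with rfl | hne
      · simp
      · rw [Function.update_of_ne (by omega)]
        exact hJ.1 t' (by omega)
    · intro j hj
      rw [Function.update_of_ne (by omega)]
      exact hJ.2 j (by omega)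
  · apply le_of_eq
    ring

/-- Fill a `p × q` matrix in the real array `a` with sums of `len` terms. -/
def matLoop (i j l : ℕ) (p q len : NExp) (x a : ℕ) (e : RExp) : Cmd :=
  forLoop i p (forLoop j q (.seq (sumLoop x l len e)
    (.rput a (.add (.mul (.reg i) q) (.reg j)) (.reg x))))

theorem mul_add_inj {q i j i' j' : ℕ} (hj : j < q) (hj' : j' < q) (h : i * q + j = i' * q + j') :
    i = i' ∧ j = j' := by
  have h1 : (i * q + j) / q = i := by
    rw [Nat.add_comm, Nat.add_mul_div_right _ _ (by omega), Nat.div_eq_of_lt hj, Nat.zero_add]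
  have h2 : (i' * q + j') / q = i' := by
    rw [Nat.add_comm, Nat.add_mul_div_right _ _ (by omega), Nat.div_eq_of_lt hj', Nat.zero_add]
  have h3 : i = i' := by rw [← h1, h, h2]
  subst h3
  exact ⟨rfl, by omega⟩

theorem Runs.matLoop {i j l : ℕ} {p q len : NExp} {x a : ℕ} {e : RExp} {s : State}
    {p' q' N : ℕ} {f : ℕ → ℕ → ℕ → ℝ} (hij : i ≠ j) (hil : i ≠ l) (hjl : j ≠ l)
    (hp : ∀ s', Agree (matLoop i j l p q len x a e) s s' → p.eval s' = p')
    (hq : ∀ s', Agree (RealRAM.matLoop i j l p q len x a e) s s' → q.eval s' = q')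
    (hlen : ∀ s', Agree (RealRAM.matLoop i j l p q len x a e) s s' → len.eval s' = N)
    (he : ∀ i' < p', ∀ j' < q', ∀ t < N, ∀ s', Agree (RealRAM.matLoop i j l p q len x a e) s s' →
      s'.nreg i = i' → s'.nreg j = j' → s'.nreg l = t → e.eval s' = f i' j' t) :
    Runs ω (RealRAM.matLoop i j l p q len x a e) s
      (p' * (q' * (N * (e.cost + len.cost + 10) + len.cost + 2 * q.cost + 21) + p.cost + q.cost + 12)
        + p.cost + 5)
      (fun s' => ∀ i' < p', ∀ j' < q', s'.rarr a (i' * q' + j') =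
        ∑ t ∈ Finset.range N, f i' j' t) := by
  refine Runs.mono (Runs.forLoop (N := p')
    (fun i₀ s' => ∀ i' < i₀, ∀ j' < q', s'.rarr a (i' * q' + j') = ∑ t ∈ Finset.range N, f i' j' t)
    ?_ hp (by simp) fun i₀ hi₀ s₁ a1 e1 J1 => Runs.mono (Runs.forLoop (N := q')
      (fun j₀ s' => (∀ i' < i₀, ∀ j' < q', s'.rarr a (i' * q' + j') = ∑ t ∈ Finset.range N, f i' j' t)
        ∧ ∀ j' < j₀, s'.rarr a (i₀ * q' + j') = ∑ t ∈ Finset.range N, f i₀ j' t)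
      ?_ (fun s₂ a2 => hq s₂ (a1.trans (a2.within (Within.forLoop _ _ _))))
      (by simpa using J1)
      fun j₀ hj₀ s₂ a2 e2 J2 => Runs.seq (Runs.sumLoop (N := N) (f := f i₀ j₀)
        (fun s₃ a3 => hlen s₃ ?_) fun t ht s₃ a3 e3 => he i₀ hi₀ j₀ hj₀ t ht s₃ ?_ ?_ ?_ e3)
        fun s₃ a3 J3 => Runs.rput ?_) le_rfl fun s₂ a2 J2 => ?_) ?_ fun _ _ h => h
  · simp [RealRAM.forLoop, RealRAM.sumLoop, Cmd.setsN, hij, hil]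
  · simp [RealRAM.forLoop, RealRAM.sumLoop, Cmd.setsN, hjl]
  · exact a1.trans ((a2.within (Within.forLoop _ _ _)).trans
      (((a3.within (Within.seq_left _ _)).within (Within.forLoop _ _ _)).within (Within.forLoop _ _ _)))
  · exact a1.trans ((a2.within (Within.forLoop _ _ _)).trans
      (((a3.within (Within.seq_left _ _)).within (Within.forLoop _ _ _)).within (Within.forLoop _ _ _)))
  · rw [a3.n i (by simp [RealRAM.forLoop, RealRAM.sumLoop, Cmd.setsN, hil]),
      a2.n i (by simp [RealRAM.forLoop, RealRAM.sumLoop, Cmd.setsN, hil, hij]), e1]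
  · rw [a3.n j (by simp [RealRAM.forLoop, RealRAM.sumLoop, Cmd.setsN, hjl]), e2]
  · have h1 : s₃.nreg i = i₀ := by
      rw [a3.n i (by simp [RealRAM.forLoop, RealRAM.sumLoop, Cmd.setsN, hil]),
        a2.n i (by simp [RealRAM.forLoop, RealRAM.sumLoop, Cmd.setsN, hil, hij]), e1]
    have h2 : s₃.nreg j = j₀ := by
      rw [a3.n j (by simp [RealRAM.forLoop, RealRAM.sumLoop, Cmd.setsN, hjl]), e2]
    have h3 : q.eval s₃ = q' := hq s₃ (a1.trans ((a2.within (Within.forLoop _ _ _)).trans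
      (((a3.within (Within.seq_left _ _)).within (Within.forLoop _ _ _)).within (Within.forLoop _ _ _))))
    have h4 : s₃.rarr a = s₂.rarr a := a3.a a (by simp [RealRAM.forLoop, RealRAM.sumLoop, Cmd.setsA])
    simp only [NExp.eval, RExp.eval, h1, h2, h3, h4, J3, Function.update_self]
    constructor
    · intro i' hi' j' hj'
      rw [Function.update_of_ne, J2.1 i' hi' j' hj']
      intro h
      have := (mul_add_inj hj' hj₀ h).1
      omega
    · intro j' hj'
      rcases eq_or_ne j' j₀ with rfl | hne
      · simp
      · rw [Function.update_of_ne (by omega)]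
        exact J2.2 j' (by omega)
  · intro i' hi' j' hj'
    rcases eq_or_ne i' i₀ with rfl | hne
    · exact J2.2 j' hj'
    · exact J2.1 i' (by omega) j' hj'
  · simp only [RExp.cost, NExp.cost]
    apply le_of_eq
    ring

end RealRAM

namespace RealRAM

variable {ω : ℕ → unitInterval}

/-! ## Rows of matrices in the memory -/

/-- The row `i` of a matrix with `d` columns that is stored row by row. -/
noncomputable def rowVec (a : ℕ → ℝ) (d i : ℕ) : Pt d := WithLp.toLp 2 fun j => a (i * d + j)

theorem inner_rowVec (a b : ℕ → ℝ) (d i l : ℕ) : inner ℝ (rowVec a d i) (rowVec b d l) =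
    ∑ t ∈ Finset.range d, a (i * d + t) * b (l * d + t) := by
  rw [PiLp.inner_apply, Finset.sum_range]
  exact Finset.sum_congr rfl fun t _ => mul_comm _ _

theorem rowVec_congr {a b : ℕ → ℝ} {d i l : ℕ} (h : ∀ t < d, a (i * d + t) = b (l * d + t)) :
    rowVec a d i = rowVec b d l := by
  ext t; exact h t t.2

/-- Subtract from the first `rows` rows of the array `a` multiples of the row `vb` of the array
`b`; the coefficients are the products of `kE` with the inner products of the rows. -/
def deflateLoop (kE : RExp) (rows : NExp) (a b : ℕ) (vb : NExp) : Cmd :=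
  forLoop 9 rows (.seq
    (sumLoop 6 10 (.reg 1) (.mul (.arr a (.add (.mul (.reg 9) (.reg 1)) (.reg 10)))
      (.arr b (.add (.mul vb (.reg 1)) (.reg 10)))))
    (fillLoop 10 (.reg 1) a (.add (.mul (.reg 9) (.reg 1)) (.reg 10))
      (.sub (.arr a (.add (.mul (.reg 9) (.reg 1)) (.reg 10)))
        (.mul (.mul kE (.reg 6)) (.arr b (.add (.mul vb (.reg 1)) (.reg 10)))))))

/-- One loop serves two purposes: `κ = 1` with a unit vector projects residuals, and `κ = 2 / ⟨v,
v⟩` applies a Householder reflection. -/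
theorem Runs.deflateLoop {kE : RExp} {rows : NExp} {a b : ℕ} {vb : NExp} {s : State}
    {R d β : ℕ} {κ : ℝ} (hab : b ≠ a) (hd : s.nreg 1 = d)
    (hR : ∀ s', Agree (deflateLoop kE rows a b vb) s s' → rows.eval s' = R)
    (hk : ∀ s', Agree (RealRAM.deflateLoop kE rows a b vb) s s' → kE.eval s' = κ)
    (hv : ∀ s', Agree (RealRAM.deflateLoop kE rows a b vb) s s' → vb.eval s' = β) :
    Runs ω (RealRAM.deflateLoop kE rows a b vb) s
      (R * (d * (kE.cost + 2 * vb.cost + 52) + rows.cost + 22) + rows.cost + 5)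
      (fun s' => ∀ l < R, rowVec (s'.rarr a) d l = rowVec (s.rarr a) d l -
        (κ * inner ℝ (rowVec (s.rarr a) d l) (rowVec (s.rarr b) d β)) • rowVec (s.rarr b) d β) := by
  refine Runs.mono (Runs.forLoop (N := R)
    (fun l₀ s' => (∀ l < l₀, rowVec (s'.rarr a) d l = rowVec (s.rarr a) d l -
        (κ * inner ℝ (rowVec (s.rarr a) d l) (rowVec (s.rarr b) d β)) • rowVec (s.rarr b) d β) ∧
      ∀ j, l₀ * d ≤ j → s'.rarr a j = s.rarr a j) rfl hR (by simp)
    fun l₀ hl₀ s₁ a1 e1 J1 => Runs.seq (Runs.sumLoop (N := d)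
      (f := fun t => s.rarr a (l₀ * d + t) * s.rarr b (β * d + t)) (fun s₂ a2 => ?_)
      fun t ht s₂ a2 e2 => ?_) fun s₂ a2 J2 => Runs.mono (Runs.fillLoop (N := d) (o := l₀ * d)
      (f := fun t => s.rarr a (l₀ * d + t) - κ * inner ℝ (rowVec (s.rarr a) d l₀)
        (rowVec (s.rarr b) d β) * s.rarr b (β * d + t)) (fun s₃ a3 => ?_)
      fun t ht s₃ a3 e3 J3 => ?_) le_rfl fun s₃ a3 J3 => ?_) ?_ fun _ _ h => h.1
  · have a2' := a1.trans ((a2.within (Within.seq_left _ _)).within (Within.forLoop _ _ _))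
    rw [NExp.eval, a2'.n 1 rfl, hd]
  · have a2' := a1.trans ((a2.within (Within.seq_left _ _)).within (Within.forLoop _ _ _))
    simp only [RExp.eval, NExp.eval, hv s₂ a2', a2'.n 1 rfl, hd, e2, a2.n 9 rfl, e1, a2.a a rfl]
    rw [J1.2 _ (by omega), a2'.a b (by simp [RealRAM.forLoop, RealRAM.sumLoop, RealRAM.fillLoop, Cmd.setsA, hab])]
  · have a3' := a1.trans (((a2.within (Within.seq_left _ _)).trans
      (a3.within (Within.seq_right _ _))).within (Within.forLoop _ _ _))
    rw [NExp.eval, a3'.n 1 rfl, hd]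
  · have a3' := a1.trans (((a2.within (Within.seq_left _ _)).trans
      (a3.within (Within.seq_right _ _))).within (Within.forLoop _ _ _))
    simp only [RExp.eval, NExp.eval, hv s₃ a3', hk s₃ a3', a3'.n 1 rfl, hd, e3, a3.n 9 rfl,
      a2.n 9 rfl, e1, true_and]
    rw [J3 _ (by omega), a2.a a rfl, J1.2 _ (by omega), a3.r 6 rfl, J2, inner_rowVec,
      a3'.a b (by simp [RealRAM.forLoop, RealRAM.sumLoop, RealRAM.fillLoop, Cmd.setsA, hab])]
  · have h2 : s₂.rarr a = s₁.rarr a := a2.a a rfl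
    constructor
    · intro l hl
      rcases eq_or_ne l l₀ with rfl | hne
      · ext t
        have := J3.1 t t.2
        simpa [rowVec] using this
      · rw [← J1.1 l (by omega)]
        refine rowVec_congr fun t ht => ?_
        have h3 : (l + 1) * d ≤ l₀ * d := Nat.mul_le_mul_right d (by omega)
        rw [Nat.succ_mul] at h3
        rw [← h2]
        exact J3.2 _ (Or.inl (by omega))
    · intro j hj
      rw [Nat.succ_mul] at hj
      have := J3.2 j (Or.inr hj)
      rw [h2, J1.2 j (by omega)] at this
      exact this
  · simp only [RExp.cost, NExp.cost]
    apply le_of_eq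
    ring

/-- The first `r` rows of a matrix are an orthonormal basis of `V`. -/
structure OrthoRows (Q : ℕ → ℝ) (d r : ℕ) (V : Submodule ℝ (Pt d)) : Prop where
  orth : ∀ a < r, ∀ b < r, inner ℝ (rowVec Q d a) (rowVec Q d b) = if a = b then (1 : ℝ) else 0
  span : Submodule.span ℝ ((fun l => rowVec Q d l) '' Set.Iio r) = V

theorem OrthoRows.zero (Q : ℕ → ℝ) (d : ℕ) : OrthoRows Q d 0 ⊥ :=
  ⟨fun a ha => by omega, by simp⟩

theorem OrthoRows.orthonormal {Q : ℕ → ℝ} {d r : ℕ} {V : Submodule ℝ (Pt d)}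
    (h : OrthoRows Q d r V) : Orthonormal ℝ fun l : Fin r => rowVec Q d l := by
  rw [orthonormal_iff_ite]
  intro i j
  rw [h.orth i i.2 j j.2]
  simp [Fin.ext_iff]

theorem OrthoRows.span_range {Q : ℕ → ℝ} {d r : ℕ} {V : Submodule ℝ (Pt d)}
    (h : OrthoRows Q d r V) : Submodule.span ℝ (Set.range fun l : Fin r => rowVec Q d l) = V := by
  rw [← h.span]
  congr 1
  ext x
  simp only [Set.mem_range, Set.mem_image, Set.mem_Iio]
  exact ⟨fun ⟨l, hl⟩ => ⟨l, l.2, hl⟩, fun ⟨l, hl, hx⟩ => ⟨⟨l, hl⟩, hx⟩⟩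

theorem OrthoRows.le_dim {Q : ℕ → ℝ} {d r : ℕ} {V : Submodule ℝ (Pt d)}
    (h : OrthoRows Q d r V) : r ≤ d := by
  simpa using h.orthonormal.linearIndependent.fintype_card_le_finrank

theorem OrthoRows.extend {Q Q' : ℕ → ℝ} {d r : ℕ} {V : Submodule ℝ (Pt d)}
    (h : OrthoRows Q d r V) (hQ : ∀ l < r, rowVec Q' d l = rowVec Q d l)
    (hq : ∀ y ∈ V, inner ℝ y (rowVec Q' d r) = 0)
    (hq1 : inner ℝ (rowVec Q' d r) (rowVec Q' d r) = (1 : ℝ)) :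
    OrthoRows Q' d (r + 1) (V ⊔ Submodule.span ℝ {rowVec Q' d r}) := by
  have hmem : ∀ l < r, rowVec Q d l ∈ V := fun l hl => by
    rw [← h.span]; exact Submodule.subset_span ⟨l, hl, rfl⟩
  constructor
  · intro a ha b hb
    rcases Nat.lt_succ_iff_lt_or_eq.1 ha with ha | rfl <;>
      rcases Nat.lt_succ_iff_lt_or_eq.1 hb with hb | rfl
    · rw [hQ a ha, hQ b hb]; exact h.orth a ha b hb
    · rw [if_neg (by omega), hQ a ha]; exact hq _ (hmem a ha)
    · rw [if_neg (by omega), hQ b hb, real_inner_comm]; exact hq _ (hmem b hb)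
    · simpa using hq1
  · have : Set.Iio (r + 1) = Set.Iio r ∪ {r} := by ext x; simp
    rw [this, Set.image_union, Submodule.span_union, Set.image_singleton]
    congr 1
    rw [← h.span]
    congr 1
    exact Set.image_congr fun l hl => hQ l hl

/-! ## Adding a row to the flat -/

/-- The memory holds an orthonormal basis of `V` and the residuals of the points `X`. -/
structure HoldsFlat {d : ℕ} (X : ℕ → Pt d) (R : ℕ) (V : Submodule ℝ (Pt d)) (s : State) :
    Prop where
  dim : s.nreg 1 = d
  rows : s.nreg 5 = R
  basis : OrthoRows (s.rarr 4) d (s.nreg 4) V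
  resid : ∀ l < R, IsResid V (X l) (rowVec (s.rarr 3) d l)

/-- Add the point with the number in register `8` to the flat. -/
def addRow : Cmd :=
  .seq (sumLoop 4 10 (.reg 1) (.mul (.arr 3 (.add (.mul (.reg 8) (.reg 1)) (.reg 10)))
      (.arr 3 (.add (.mul (.reg 8) (.reg 1)) (.reg 10)))))
    (.ite (.rlt (.ofNat (.lit 0)) (.reg 4))
      (.seq (.rset 5 (.sqrt (.reg 4)))
        (.seq (fillLoop 10 (.reg 1) 4 (.add (.mul (.reg 4) (.reg 1)) (.reg 10))
            (.div (.arr 3 (.add (.mul (.reg 8) (.reg 1)) (.reg 10))) (.reg 5)))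
          (.seq (deflateLoop (.ofNat (.lit 1)) (.reg 5) 3 4 (.reg 4))
            (.nset 4 (.add (.reg 4) (.lit 1))))))
      .skip)

/-- A modified Gram-Schmidt step: the residual of the new point is already stored, so normalizing it
gives the next basis vector, and deflating all stored rows by it costs O(Rd) independently of the
dimension of `V`. A zero residual means that the point lies in `V`, and nothing is added. -/
theorem Runs.addRow {d : ℕ} {X : ℕ → Pt d} {R : ℕ} {V : Submodule ℝ (Pt d)} {s : State}
    (h : HoldsFlat X R V s) (hd : 0 < d) (hi : s.nreg 8 < R) :
    Runs ω addRow s (160 * (R * d)) (fun s' =>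
      HoldsFlat X R (V ⊔ Submodule.span ℝ {X (s.nreg 8)}) s' ∧ s'.nreg 4 ≤ s.nreg 4 + 1) := by
  set i := s.nreg 8 with hi_def
  set e := rowVec (s.rarr 3) d i with he
  have hres : IsResid V (X i) e := h.resid i hi
  refine Runs.mono (Runs.seq (Runs.sumLoop (N := d)
    (f := fun t => s.rarr 3 (i * d + t) * s.rarr 3 (i * d + t)) (fun s₁ a1 => ?_)
    fun t ht s₁ a1 e1 => ?_) fun s₁ a1 J1 => Runs.ite (t := 56 * (R * d) + 23 * R + 22 * d + 19)
      (fun hb => Runs.mono (Runs.seq (Runs.rset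
        (Q := fun s' => s'.rreg 5 = ‖e‖) ?_) fun s₂ a2 J2 =>
        Runs.seq (Runs.fillLoop (N := d) (o := s.nreg 4 * d)
          (f := fun t => s.rarr 3 (i * d + t) / ‖e‖) (fun s₃ a3 => ?_) fun t ht s₃ a3 e3 J3 => ?_)
        fun s₃ a3 J3 => Runs.seq (Runs.deflateLoop (R := R) (d := d) (β := s.nreg 4) (κ := 1)
          (by decide) ?_ (fun s₄ a4 => ?_) (fun s₄ a4 => ?_) fun s₄ a4 => ?_) fun s₄ a4 J4 =>
          Runs.nset ?_) ?_ fun _ _ h => h)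
      fun hb => Runs.mono (Runs.skip ?_) ?_ fun _ _ h => h) ?_ fun _ _ h => h
  · rw [NExp.eval, a1.n 1 rfl, h.dim]
  · simp only [RExp.eval, NExp.eval, a1.n 1 rfl, a1.n 8 rfl, h.dim, e1, a1.a 3 rfl, ← hi_def]
  · rw [← inner_rowVec, real_inner_self_eq_norm_sq] at J1
    simp only [Function.update_self, RExp.eval, J1]
    exact Real.sqrt_sq (norm_nonneg _)
  · rw [NExp.eval, a3.n 1 rfl, a2.n 1 rfl, a1.n 1 rfl, h.dim]
  · simp only [RExp.eval, NExp.eval, a3.n 1 rfl, a3.n 8 rfl, a3.n 4 rfl, a2.n 1 rfl, a2.n 8 rfl,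
      a2.n 4 rfl, a1.n 1 rfl, a1.n 8 rfl, a1.n 4 rfl, h.dim, e3, a3.a 3 rfl, a2.a 3 rfl,
      a1.a 3 rfl, a3.r 5 rfl, J2, ← hi_def, and_self]
  · rw [a3.n 1 rfl, a2.n 1 rfl, a1.n 1 rfl, h.dim]
  · rw [NExp.eval, a4.n 5 rfl, a3.n 5 rfl, a2.n 5 rfl, a1.n 5 rfl, h.rows]
  · simp [RExp.eval, NExp.eval]
  · rw [NExp.eval, a4.n 4 rfl, a3.n 4 rfl, a2.n 4 rfl, a1.n 4 rfl]
  · have hn : s₄.nreg 4 = s.nreg 4 := by rw [a4.n 4 rfl, a3.n 4 rfl, a2.n 4 rfl, a1.n 4 rfl]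
    have h3 : s₃.rarr 3 = s.rarr 3 := by rw [a3.a 3 rfl, a2.a 3 rfl, a1.a 3 rfl]
    have h24 : s₂.rarr 4 = s.rarr 4 := by rw [a2.a 4 rfl, a1.a 4 rfl]
    have h34 : s₄.rarr 4 = s₃.rarr 4 := a4.a 4 rfl
    have hpos : 0 < ‖e‖ := by
      rw [← inner_rowVec, real_inner_self_eq_norm_sq] at J1
      simp only [BExp.holds, RExp.eval, NExp.eval, Nat.cast_zero, J1] at hb
      exact lt_of_le_of_ne (norm_nonneg _) fun h0 => by rw [he] at h0; rw [← h0] at hb; simp at hb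
    set q := rowVec (s₃.rarr 4) d (s.nreg 4) with hq
    have heq : e = ‖e‖ • q := by
      ext t
      have := J3.1 t t.2
      have h5 : q t = s.rarr 3 (i * d + t) / ‖e‖ := this
      have h6 : e t = s.rarr 3 (i * d + t) := rfl
      rw [PiLp.smul_apply, h5, h6, smul_eq_mul]
      field_simp
    have hqe : q = ‖e‖⁻¹ • e := by
      conv_rhs => rw [heq, norm_smul, norm_norm]
      have hq1 : ‖q‖ = 1 := by
        have := congrArg norm heq
        rw [norm_smul, norm_norm] at this
        have h7 : ‖e‖ * 1 = ‖e‖ * ‖q‖ := by rw [mul_one]; exact this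
        exact (mul_left_cancel₀ hpos.ne' h7).symm
      rw [hq1, mul_one, smul_smul, inv_mul_cancel₀ hpos.ne', one_smul]
    have hqV : ∀ y ∈ V, inner ℝ y q = 0 := fun y hy => by
      rw [hqe, inner_smul_right, hres.2 y hy, mul_zero]
    have hq1 : inner ℝ q q = (1 : ℝ) := by
      rw [hqe, inner_smul_left, inner_smul_right, real_inner_self_eq_norm_sq]
      simp
      field_simp
    have hrows : ∀ l < s.nreg 4, rowVec (s₃.rarr 4) d l = rowVec (s.rarr 4) d l := fun l hl => by
      refine rowVec_congr fun t ht => ?_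
      have h8 : (l + 1) * d ≤ s.nreg 4 * d := Nat.mul_le_mul_right d (by omega)
      rw [Nat.succ_mul] at h8
      rw [J3.2 _ (Or.inl (by omega)), h24]
    rw [hres.span_sup hpos.ne' heq]
    simp only [NExp.eval, hn]
    refine ⟨⟨?_, ?_, ?_, ?_⟩, by simp⟩
    · simp [a4.n 1 rfl, a3.n 1 rfl, a2.n 1 rfl, a1.n 1 rfl, h.dim]
    · simp [a4.n 5 rfl, a3.n 5 rfl, a2.n 5 rfl, a1.n 5 rfl, h.rows]
    · simp only [Function.update_self, h34]
      exact h.basis.extend hrows hqV hq1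
    · intro l hl
      have := J4 l hl
      rw [one_mul, h3] at this
      simp only
      rw [this]
      exact (h.resid l hl).deflate hqV hq1
  · simp only [RExp.cost, NExp.cost]
    apply le_of_eq
    ring
  · have he0 : e = 0 := by
      rw [← inner_rowVec, real_inner_self_eq_norm_sq] at J1
      simp only [BExp.holds, RExp.eval, NExp.eval, Nat.cast_zero, J1] at hb
      by_contra h0
      exact hb (by have := norm_pos_iff.2 h0; positivity)
    have hV : V ⊔ Submodule.span ℝ {X i} = V := by
      rw [sup_eq_left, Submodule.span_singleton_le_iff_mem]
      exact hres.mem_of_eq_zero he0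
    rw [hV, a1.n 4 rfl]
    refine ⟨⟨by rw [a1.n 1 rfl, h.dim], by rw [a1.n 5 rfl, h.rows], ?_, ?_⟩, by omega⟩
    · rw [a1.n 4 rfl, a1.a 4 rfl]; exact h.basis
    · rw [a1.a 3 rfl]; exact h.resid
  · omega
  · simp only [RExp.cost, NExp.cost, BExp.cost]
    have h1 : 1 * d ≤ R * d := Nat.mul_le_mul_right d (by omega)
    have h2 : R * 1 ≤ R * d := Nat.mul_le_mul_left R hd
    omega

end RealRAM

namespace RealRAM

variable {ω : ℕ → unitInterval}

theorem HoldsFlat.update {d : ℕ} {X : ℕ → Pt d} {R : ℕ} {V : Submodule ℝ (Pt d)} {s : State}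
    (h : HoldsFlat X R V s) {x : ℕ} (v : ℕ) (h1 : x ≠ 1) (h4 : x ≠ 4) (h5 : x ≠ 5) :
    HoldsFlat X R V { s with nreg := Function.update s.nreg x v } := by
  refine ⟨?_, ?_, ?_, h.resid⟩
  · simp [Function.update_of_ne h1.symm, h.dim]
  · simp [Function.update_of_ne h5.symm, h.rows]
  · simp only [Function.update_of_ne h4.symm]; exact h.basis

theorem HoldsFlat.congr {d : ℕ} {X : ℕ → Pt d} {R : ℕ} {V : Submodule ℝ (Pt d)} {s s' : State}
    (h : HoldsFlat X R V s) {c : Cmd} (ha : Agree c s s')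
    (h1 : c.setsN 1 = false ∧ c.setsN 4 = false ∧ c.setsN 5 = false)
    (h3 : c.setsA 3 = false ∧ c.setsA 4 = false) : HoldsFlat X R V s' := by
  refine ⟨?_, ?_, ?_, ?_⟩
  · rw [ha.n 1 h1.1, h.dim]
  · rw [ha.n 5 h1.2.2, h.rows]
  · rw [ha.n 4 h1.2.1, ha.a 4 h3.2]; exact h.basis
  · rw [ha.a 3 h3.1]; exact h.resid

/-! ## Adding a segment of the points -/

/-- Add the points from the number in register `12` on, as many as register `11` says. -/
def addRows : Cmd := forLoop 13 (.reg 11) (.seq (.nset 8 (.add (.reg 12) (.reg 13))) addRow)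

theorem Runs.addRows {d : ℕ} {X : ℕ → Pt d} {R lo m : ℕ} {s : State}
    (h : HoldsFlat X R ⊥ s) (hr : s.nreg 4 = 0) (hd : 0 < d) (hlo : s.nreg 12 = lo)
    (hm : s.nreg 11 = m) (hR : lo + m ≤ R) :
    Runs ω addRows s (m * (160 * (R * d) + 12) + 6) (fun s' =>
      HoldsFlat X R (Submodule.span ℝ (X '' Set.Ico lo (lo + m))) s' ∧ s'.nreg 4 ≤ m) := by
  refine Runs.mono (Runs.forLoop (N := m) (fun t s' =>
      HoldsFlat X R (Submodule.span ℝ (X '' Set.Ico lo (lo + t))) s' ∧ s'.nreg 4 ≤ t) rfl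
      (fun s' a => by rw [NExp.eval, a.n 11 rfl, hm]) ?_ fun t ht s₁ a1 e1 J1 =>
      Runs.seq (Runs.nset (Q := fun s' => s'.nreg 8 = lo + t) ?_)
      fun s₂ a2 J2 => Runs.mono (Runs.addRow (J1.1.congr a2 ⟨rfl, rfl, rfl⟩ ⟨rfl, rfl⟩) hd ?_)
        le_rfl fun s₃ a3 J3 => ?_) ?_ fun _ _ h => h
  · simp [hr]
    simpa using h.update 0 (x := 13) (by decide) (by decide) (by decide)
  · simp [NExp.eval, a1.n 12 rfl, hlo, e1]
  · rw [J2]; omega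
  · have h1 : Set.Ico lo (lo + (t + 1)) = Set.Ico lo (lo + t) ∪ {lo + t} := by
      ext x; simp; omega
    rw [h1, Set.image_union, Set.image_singleton, Submodule.span_union]
    rw [J2] at J3
    refine ⟨J3.1.update _ (by decide) (by decide) (by decide), ?_⟩
    have h2 : s₂.nreg 4 = s₁.nreg 4 := a2.n 4 rfl
    simp
    have := J3.2
    have := J1.2
    omega
  · simp only [NExp.cost]
    apply le_of_eq
    ring

/-! ## Sampling -/

/-- Put a random index into register `8`; the weights are in the array `5` and their sum is in
register `7`. -/
def selectIndex : Cmd :=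
  .seq (.rand 8) (.seq (.rset 8 (.mul (.reg 8) (.reg 7))) (.seq (.nset 8 (.lit 0))
    (.loop (.and (.nlt (.add (.reg 8) (.lit 1)) (.reg 0)) (.rlt (.arr 5 (.reg 8)) (.reg 8)))
      (.seq (.rset 8 (.sub (.reg 8) (.arr 5 (.reg 8)))) (.nset 8 (.add (.reg 8) (.lit 1)))))))

/-- Partial sums are not stored; the loop subtracts each passed weight from the level and compares
the rest with the next weight. -/
theorem Runs.selectIndex {n : ℕ} {w : ℕ → ℝ} {W : ℝ} {s : State} (hn : 0 < n)
    (h0 : s.nreg 0 = n) (hw : ∀ i < n, s.rarr 5 i = w i) (hW : s.rreg 7 = W) :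
    Runs ω selectIndex s (38 * n) (fun s' => s'.nreg 8 = sel w n ((ω s.pos).1 * W) ∧
      s'.pos = s.pos + 1) := by
  set y := (ω s.pos).1 * W with hy
  obtain ⟨hreach, hbelow⟩ := sel_eq_iff.1 (rfl : sel w n y = _)
  have hN := sel_lt (w := w) hn y
  set N := sel w n y
  refine Runs.mono (Runs.seq (Runs.rand (Q := fun s' => s'.rreg 8 = (ω s.pos).1 ∧ s'.pos = s.pos + 1)
    (by simp)) fun s₁ a1 J1 => Runs.seq (Runs.rset (Q := fun s' => s'.rreg 8 = y) ?_)
    fun s₂ a2 J2 => Runs.seq (Runs.nset (Q := fun s' => s'.nreg 8 = 0) (by simp [NExp.eval]))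
    fun s₃ a3 J3 => Runs.loop (N := N) (T := 9) (fun t s' => s'.nreg 8 = t ∧
      s'.rreg 8 = y - ∑ l ∈ Finset.range t, w l ∧ s'.rarr 5 = s.rarr 5 ∧ s'.pos = s.pos + 1) ?_
    (fun t ht s' a J => ⟨?_, Runs.seq (Runs.rset (Q := fun s' =>
      s'.rreg 8 = y - ∑ l ∈ Finset.range (t + 1), w l) ?_) fun s'' a'' J'' => Runs.nset ?_⟩)
    fun s' a J => ?_) ?_ fun s' a h => ⟨h.1, h.2.2.2⟩
  · simp only [RExp.eval, Function.update_self, J1.1, a1.r 7 rfl, hW]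
    rfl
  · refine ⟨J3, ?_, ?_, ?_⟩
    · rw [a3.r 8 rfl, J2]; simp
    · rw [a3.a 5 rfl, a2.a 5 rfl, a1.a 5 rfl]
    · rw [a3.p rfl, a2.p rfl, J1.2]
  · obtain ⟨g1, g2⟩ := not_or.1 (hbelow t ht)
    rw [Finset.sum_range_succ] at g2
    simp only [BExp.holds, NExp.eval, RExp.eval, J.1, J.2.1, J.2.2.1, a.n 0 rfl, a3.n 0 rfl,
      a2.n 0 rfl, a1.n 0 rfl, h0, hw t (by omega)]
    exact ⟨by omega, by linarith⟩
  · simp only [RExp.eval, NExp.eval, Function.update_self, J.1, J.2.1, J.2.2.1, hw t (by omega),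
      Finset.sum_range_succ]
    ring
  · simp only [NExp.eval, a''.n 8 rfl, J.1, Function.update_self, true_and]
    exact ⟨J'', by rw [a''.a 5 rfl, J.2.2.1], by rw [a''.p rfl, J.2.2.2]⟩
  · simp only [BExp.holds, NExp.eval, RExp.eval, J.1, J.2.1, J.2.2.1, a.n 0 rfl, a3.n 0 rfl,
      a2.n 0 rfl, a1.n 0 rfl, h0, hw N hN]
    rw [Finset.sum_range_succ] at hreach
    rintro ⟨g1, g2⟩
    rcases hreach with hs | hs
    · omega
    · linarith
  · simp only [RExp.cost, NExp.cost, BExp.cost]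
    omega

/-- A round of sampling. -/
def sampleCmd : Cmd :=
  .seq (matLoop 14 9 10 (.reg 0) (.lit 1) (.reg 1) 4 5
    (.mul (.arr 3 (.add (.mul (.reg 14) (.reg 1)) (.reg 10)))
      (.arr 3 (.add (.mul (.reg 14) (.reg 1)) (.reg 10)))))
    (.seq (sumLoop 7 10 (.reg 0) (.arr 5 (.reg 10)))
      (forLoop 14 (.reg 7) (.seq selectIndex addRow)))

/-- Forget the first `p` members of a sequence. -/
def dropSeq {α : Type*} (p : ℕ) (ω : ℕ → α) : ℕ → α := fun j => ω (p + j)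

/-- The continuation `next` is universally quantified so that the remaining rounds can be put in its
place. The weights are computed once, from the residuals at the start of the round, and only the
first `n` of the `R` rows are sampled. -/
theorem Runs.sampleCmd {d n S : ℕ} {X : ℕ → Pt d} {R : ℕ} {V : Submodule ℝ (Pt d)} {s : State}
    (h : HoldsFlat X R V s) (hd : 0 < d) (hn : 0 < n) (h0 : s.nreg 0 = n) (hS : s.nreg 7 = S)
    (hS0 : 0 < S) (hR : n ≤ R) :
    Runs ω sampleCmd s (302 * (S * (R * d))) (fun s' => ∃ V', HoldsFlat X R V' s' ∧
      (∀ next, sampleRound X n (residWeight X V) next S V (dropSeq s.pos ω) =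
        next V' (dropSeq s'.pos ω)) ∧ s'.nreg 4 ≤ s.nreg 4 + S) := by
  set w := residWeight X V
  have hw : ∀ A : ℕ → ℝ, (∀ i < n, ∀ j < 1, A (i * 1 + j) =
      ∑ t ∈ Finset.range d, s.rarr 3 (i * d + t) * s.rarr 3 (i * d + t)) → ∀ i < n, A i = w i := by
    intro A hA i hi
    have := hA i hi 0 one_pos
    rw [mul_one, add_zero, ← inner_rowVec, real_inner_self_eq_norm_sq] at this
    rw [this, ← (h.resid i (by omega)).infDist_eq]
    rfl
  refine Runs.mono (Runs.seq (Runs.matLoop (p' := n) (q' := 1) (N := d)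
    (f := fun i _ t => s.rarr 3 (i * d + t) * s.rarr 3 (i * d + t)) (by decide) (by decide)
    (by decide) (fun s₁ a1 => ?_) (fun s₁ a1 => rfl) (fun s₁ a1 => ?_)
    fun i hi j hj t ht s₁ a1 e1 e2 e3 => ?_) fun s₁ a1 J1 => Runs.seq (Runs.sumLoop (N := n)
    (f := w) (fun s₂ a2 => ?_) fun t ht s₂ a2 e2 => ?_) fun s₂ a2 J2 => Runs.mono (Runs.forLoop (N := S)
      (T := 38 * n + 160 * (R * d))
      (fun l s' => ∃ V', HoldsFlat X R V' s' ∧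
      (∀ next, sampleRound X n w next S V (dropSeq s.pos ω) =
        sampleRound X n w next (S - l) V' (dropSeq s'.pos ω)) ∧ s'.nreg 4 ≤ s.nreg 4 + l) rfl
      (fun s₃ a3 => ?_) ?_ fun t ht s₃ a3 e3 J3 => Runs.seq (Runs.selectIndex hn ?_
        (w := w) (fun i hi => ?_) rfl) fun s₄ a4 J4 => ?_) le_rfl fun s₃ a3 J3 => ?_) ?_ fun _ _ h => h
  · rw [NExp.eval, a1.n 0 rfl, h0]
  · rw [NExp.eval, a1.n 1 rfl, h.dim]
  · simp only [RExp.eval, NExp.eval, a1.n 1 rfl, h.dim, e1, e3, a1.a 3 rfl]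
  · rw [NExp.eval, a2.n 0 rfl, a1.n 0 rfl, h0]
  · simp only [RExp.eval, NExp.eval, e2, a2.a 5 rfl]
    exact hw _ J1 t ht
  · rw [NExp.eval, a3.n 7 rfl, a2.n 7 rfl, a1.n 7 rfl, hS]
  · refine ⟨V, ?_, fun next => ?_, ?_⟩
    · exact ((h.congr a1 ⟨rfl, rfl, rfl⟩ ⟨rfl, rfl⟩).congr a2 ⟨rfl, rfl, rfl⟩ ⟨rfl, rfl⟩).update _
        (by decide) (by decide) (by decide)
    · simp [a2.p rfl, a1.p rfl]
    · simp [a2.n 4 rfl, a1.n 4 rfl]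
  · rw [a3.n 0 rfl, a2.n 0 rfl, a1.n 0 rfl, h0]
  · rw [a3.a 5 rfl, a2.a 5 rfl, hw _ J1 i hi]
  · obtain ⟨V', hV', hnext, hr⟩ := J3
    have h4 : HoldsFlat X R V' s₄ := hV'.congr a4 ⟨rfl, rfl, rfl⟩ ⟨rfl, rfl⟩
    have hlt : s₄.nreg 8 < R := by rw [J4.1]; exact (sel_lt hn _).trans_le hR
    refine Runs.mono (Runs.addRow h4 hd hlt) le_rfl fun s₅ a5 J5 => ?_
    refine ⟨_, J5.1.update _ (by decide) (by decide) (by decide), fun next => ?_, ?_⟩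
    · have hl : S - t = (S - (t + 1)) + 1 := by omega
      have h7 : s₃.rreg 7 = ∑ i ∈ Finset.range n, w i := by rw [a3.r 7 rfl, J2]
      have hp : s₅.pos = s₃.pos + 1 := by rw [a5.p rfl, J4.2]
      rw [hnext next, hl, sampleRound]
      rw [J4.1, h7]
      congr 1
      funext j
      simp only [dropSeq, hp]
      congr 1
      omega
    · have h4' : s₄.nreg 4 = s₃.nreg 4 := a4.n 4 rfl
      have := J5.2
      simp
      omega
  · obtain ⟨V', hV', hnext, hr⟩ := J3
    refine ⟨V', hV', fun next => ?_, hr⟩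
    rw [hnext next, Nat.sub_self, sampleRound]
  · simp only [RExp.cost, NExp.cost]
    have g1 : n * d ≤ R * d := Nat.mul_le_mul_right d hR
    have g2 : R * 1 ≤ R * d := Nat.mul_le_mul_left R hd
    have g3 : 1 * (R * d) ≤ S * (R * d) := Nat.mul_le_mul_right _ hS0
    have g4 : S * n ≤ S * (R * d) := Nat.mul_le_mul_left S (by omega)
    have g5 : S * 1 ≤ S * (R * d) := Nat.mul_le_mul_left S (by omega)
    ring_nf at *
    omega

/-- All rounds of sampling. -/
def sampleLoop : Cmd := forLoop 13 (.reg 6) sampleCmd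

theorem Runs.sampleLoop {d n S T : ℕ} {X : ℕ → Pt d} {R : ℕ} {V : Submodule ℝ (Pt d)} {s : State}
    (h : HoldsFlat X R V s) (hd : 0 < d) (hn : 0 < n) (h0 : s.nreg 0 = n) (hS : s.nreg 7 = S)
    (hT : s.nreg 6 = T) (hS0 : 0 < S) (hR : n ≤ R) :
    Runs ω sampleLoop s (T * (302 * (S * (R * d)) + 8) + 6) (fun s' =>
      HoldsFlat X R (adaptiveFlat X n S T V (dropSeq s.pos ω)) s' ∧
        s'.nreg 4 ≤ s.nreg 4 + T * S) := by
  refine Runs.mono (Runs.forLoop (N := T) (T := 302 * (S * (R * d))) (fun l s' => ∃ V', HoldsFlat X R V' s' ∧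
      adaptiveFlat X n S T V (dropSeq s.pos ω) =
        adaptiveFlat X n S (T - l) V' (dropSeq s'.pos ω) ∧ s'.nreg 4 ≤ s.nreg 4 + l * S) rfl
      (fun s₁ a1 => ?_) ?_ fun t ht s₁ a1 e1 J1 => ?_) ?_ fun s₁ a1 J1 => ?_
  · rw [NExp.eval, a1.n 6 rfl, hT]
  · exact ⟨V, h.update _ (by decide) (by decide) (by decide), rfl, by simp⟩
  · obtain ⟨V', hV', hnext, hr⟩ := J1
    refine Runs.mono (Runs.sampleCmd hV' hd hn (by rw [a1.n 0 rfl, h0]) (by rw [a1.n 7 rfl, hS])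
      hS0 hR) le_rfl fun s₂ a2 J2 => ?_
    obtain ⟨V'', hV'', hnext', hr'⟩ := J2
    refine ⟨V'', hV''.update _ (by decide) (by decide) (by decide), ?_, ?_⟩
    · have hl : T - t = (T - (t + 1)) + 1 := by omega
      rw [hnext, hl, adaptiveFlat, hnext']
    · simp [Nat.succ_mul]
      omega
  · simp only [NExp.cost]
    apply le_of_eq
    ring
  · obtain ⟨V', hV', hnext, hr⟩ := J1
    rw [hnext, Nat.sub_self, adaptiveFlat]
    exact ⟨hV', hr⟩

end RealRAM

/-! ## Householder reflections -/

/-- The reflection in the hyperplane orthogonal to `v`. -/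
noncomputable def householder {d : ℕ} (v x : Pt d) : Pt d :=
  x - (2 / inner ℝ v v * inner ℝ x v : ℝ) • v

/-- For `v = 0` the convention `2 / 0 = 0`, shared by the machine, makes the map the identity, so
the program needs no test for a zero vector. -/
theorem inner_householder {d : ℕ} (v x y : Pt d) :
    inner ℝ (householder v x) (householder v y) = (inner ℝ x y : ℝ) := by
  unfold householder
  rcases eq_or_ne v 0 with rfl | hv
  · simp
  · have hvv : (inner ℝ v v : ℝ) ≠ 0 := by simpa using hv
    rw [inner_sub_left, inner_sub_right, inner_sub_right]
    simp only [inner_smul_left, inner_smul_right, conj_trivial]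
    rw [real_inner_comm y v]
    field_simp
    ring

theorem householder_of_inner_eq_zero {d : ℕ} {v x : Pt d} (h : inner ℝ x v = (0 : ℝ)) :
    householder v x = x := by
  simp [householder, h]

theorem householder_sub {d : ℕ} {b q : Pt d} (h : inner ℝ b b = (inner ℝ q q : ℝ)) :
    householder (b - q) b = q := by
  rcases eq_or_ne b q with rfl | hbq
  · simp [householder]
  · have hvv : (inner ℝ (b - q) (b - q) : ℝ) ≠ 0 := by simpa [sub_eq_zero] using hbq
    have h1 : 2 / inner ℝ (b - q) (b - q) * inner ℝ b (b - q) = (1 : ℝ) := by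
      rw [div_mul_eq_mul_div, div_eq_one_iff_eq hvv]
      simp only [inner_sub_left, inner_sub_right, real_inner_comm b q, h]
      ring
    rw [householder, h1, one_smul, sub_sub_cancel]

namespace RealRAM

variable {ω : ℕ → unitInterval}

/-! ## Writing the output -/

/-- Complete the orthonormal rows in the array `8` to an orthonormal family in the array `2`. -/
def completeRows : Cmd :=
  .seq (forLoop 13 (.reg 2) (.rput 2 (.add (.mul (.reg 13) (.reg 1)) (.reg 13)) (.ofNat (.lit 1))))
    (forLoop 13 (.reg 15) (.seq
      (fillLoop 10 (.reg 1) 9 (.reg 10) (.sub (.arr 2 (.add (.mul (.reg 13) (.reg 1)) (.reg 10)))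
        (.arr 8 (.add (.mul (.reg 13) (.reg 1)) (.reg 10)))))
      (.seq (sumLoop 4 10 (.reg 1) (.mul (.arr 9 (.reg 10)) (.arr 9 (.reg 10))))
        (deflateLoop (.div (.ofNat (.lit 2)) (.reg 4)) (.reg 2) 2 9 (.lit 0)))))

/-- Starting from the first `k` coordinate vectors, the reflection number `l₀` carries row `l₀` to
its target. Earlier rows already equal their targets, which are orthogonal both to row `l₀` and to
its target, so they stay fixed. This needs only `r` reflections of `k` rows. -/
theorem Runs.completeRows {d k r : ℕ} {s : State} (hd : s.nreg 1 = d) (hk : s.nreg 2 = k)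
    (hr : s.nreg 15 = r) (hrk : r ≤ k) (hkd : k ≤ d) (h2 : ∀ j, s.rarr 2 j = 0)
    (h8 : ∀ a < r, ∀ b < r, inner ℝ (rowVec (s.rarr 8) d a) (rowVec (s.rarr 8) d b) =
      if a = b then (1 : ℝ) else 0) :
    Runs ω completeRows s (16 * k + 12 + r * (58 * (k * d) + 23 * k + 39 * d + 29)) (fun s' =>
      (∀ a < k, ∀ b < k, inner ℝ (rowVec (s'.rarr 2) d a) (rowVec (s'.rarr 2) d b) =
        if a = b then (1 : ℝ) else 0) ∧
      ∀ l < r, rowVec (s'.rarr 2) d l = rowVec (s.rarr 8) d l) := by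
  refine Runs.mono (Runs.seq (Runs.forLoop (N := k) (T := 8) (fun j₀ s' => ∀ i < k, ∀ j < d,
      s'.rarr 2 (i * d + j) = if i < j₀ ∧ i = j then 1 else 0) rfl (fun s₁ a1 => ?_)
      (by simp [h2]) fun j₀ hj₀ s₁ a1 e1 J1 => Runs.rput ?_) fun s₁ a1 J1 =>
    Runs.forLoop (N := r) (T := 58 * (k * d) + 23 * k + 39 * d + 21) (fun l₀ s' =>
      (∀ a < k, ∀ b < k, inner ℝ (rowVec (s'.rarr 2) d a) (rowVec (s'.rarr 2) d b) =
        if a = b then (1 : ℝ) else 0) ∧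
      ∀ l < l₀, rowVec (s'.rarr 2) d l = rowVec (s.rarr 8) d l) rfl (fun s₂ a2 => ?_) ?_
      fun l₀ hl₀ s₂ a2 e2 J2 => Runs.mono (Runs.seq (Runs.fillLoop (N := d) (o := 0)
        (f := fun t => s₂.rarr 2 (l₀ * d + t) - s.rarr 8 (l₀ * d + t)) (fun s₃ a3 => ?_)
        fun t ht s₃ a3 e3 J3 => ?_) fun s₃ a3 J3 => Runs.seq (Runs.sumLoop (N := d)
        (f := fun t => s₃.rarr 9 (0 * d + t) * s₃.rarr 9 (0 * d + t)) (fun s₄ a4 => ?_)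
        fun t ht s₄ a4 e4 => ?_) fun s₄ a4 J4 => Runs.mono (Runs.deflateLoop (R := k) (d := d) (β := 0)
        (κ := 2 / inner ℝ (rowVec (s₃.rarr 9) d 0) (rowVec (s₃.rarr 9) d 0))
        (show 9 ≠ 2 by decide) ?_ (fun s₅ a5 => ?_) (fun s₅ a5 => ?_) fun s₅ a5 => rfl) le_rfl
        fun s₅ a5 J5 => ?_) ?_ fun _ _ h => h) ?_ fun _ _ h => h
  · rw [NExp.eval, a1.n 2 rfl, hk]
  · intro i hi j hj
    simp only [NExp.eval, RExp.eval, e1, a1.n 1 rfl, hd, Function.update_self]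
    by_cases h : i * d + j = j₀ * d + j₀
    · obtain ⟨rfl, rfl⟩ := mul_add_inj hj (by omega) h
      simp
    · rw [Function.update_of_ne h, J1 i hi j hj]
      have : ¬ (i = j₀ ∧ j = j₀) := by rintro ⟨rfl, rfl⟩; exact h rfl
      congr 1
      apply propext
      constructor <;> intro h' <;> refine ⟨?_, h'.2⟩ <;> omega
  · rw [NExp.eval, a2.n 15 rfl, a1.n 15 rfl, hr]
  · refine ⟨fun a ha b hb => ?_, by simp⟩
    rw [inner_rowVec, Finset.sum_congr rfl fun t ht => by
      rw [J1 a ha t (Finset.mem_range.1 ht), J1 b hb t (Finset.mem_range.1 ht)]]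
    by_cases hab : a = b
    · subst hab
      rw [if_pos rfl, Finset.sum_eq_single a]
      · simp [ha]
      · intro t _ ht; simp [ht.symm]
      · simp; omega
    · rw [if_neg hab]
      refine Finset.sum_eq_zero fun t _ => ?_
      by_cases h : a = t
      · subst h
        have : b ≠ a := fun h => hab h.symm
        simp [this]
      · simp [h]
  · rw [NExp.eval, a3.n 1 rfl, a2.n 1 rfl, a1.n 1 rfl, hd]
  · simp only [NExp.eval, RExp.eval, e3, a3.n 13 rfl, e2, a3.n 1 rfl, a2.n 1 rfl, a1.n 1 rfl, hd,
      a3.a 2 rfl, a3.a 8 rfl, a2.a 8 rfl, a1.a 8 rfl, zero_add, and_self]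
  · rw [NExp.eval, a4.n 1 rfl, a3.n 1 rfl, a2.n 1 rfl, a1.n 1 rfl, hd]
  · simp only [NExp.eval, RExp.eval, e4, a4.a 9 rfl, zero_mul, zero_add]
  · rw [a4.n 1 rfl, a3.n 1 rfl, a2.n 1 rfl, a1.n 1 rfl, hd]
  · rw [NExp.eval, a5.n 2 rfl, a4.n 2 rfl, a3.n 2 rfl, a2.n 2 rfl, a1.n 2 rfl, hk]
  · simp only [RExp.eval, NExp.eval, a5.r 4 rfl, J4, inner_rowVec]
    norm_num
  · set v := rowVec (s₃.rarr 9) d 0 with hv_def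
    have hv : v = rowVec (s₂.rarr 2) d l₀ - rowVec (s.rarr 8) d l₀ := by
      ext t
      have := J3.1 t t.2
      rw [zero_add] at this
      simp only [hv_def, rowVec, zero_mul, zero_add]
      exact this
    have h42 : s₄.rarr 2 = s₂.rarr 2 := by rw [a4.a 2 rfl, a3.a 2 rfl]
    have h49 : s₄.rarr 9 = s₃.rarr 9 := a4.a 9 rfl
    have J : ∀ l < k, rowVec (s₅.rarr 2) d l = householder v (rowVec (s₂.rarr 2) d l) := by
      intro l hl
      have := J5 l hl
      rw [h42, h49] at this
      exact this
    refine ⟨fun a ha b hb => ?_, fun l hl => ?_⟩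
    · simp only
      rw [J a ha, J b hb, inner_householder]
      exact J2.1 a ha b hb
    · simp only
      rw [J l (by omega)]
      rcases Nat.lt_succ_iff_lt_or_eq.1 hl with hl' | rfl
      · rw [householder_of_inner_eq_zero, J2.2 l hl']
        rw [hv, inner_sub_right, J2.1 l (by omega) l₀ (by omega), if_neg (by omega), J2.2 l hl',
          h8 l (by omega) l₀ hl₀, if_neg (by omega), sub_zero]
      · rw [hv, householder_sub]
        rw [J2.1 l (by omega) l (by omega), h8 l hl₀ l hl₀]
  · simp only [RExp.cost, NExp.cost]
    apply le_of_eq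
    ring
  · simp only [NExp.cost]
    apply le_of_eq
    ring

/-- Compute the best flat inside the current flat and write its basis into the array `2`. -/
def finish : Cmd :=
  .seq (.ite (.nlt (.reg 4) (.reg 2)) (.nset 15 (.reg 4)) (.nset 15 (.reg 2)))
    (.seq (matLoop 13 14 10 (.reg 0) (.reg 4) (.reg 1) 4 6
        (.mul (.arr 0 (.add (.mul (.reg 13) (.reg 1)) (.reg 10)))
          (.arr 4 (.add (.mul (.reg 14) (.reg 1)) (.reg 10)))))
      (.seq (.svd (.reg 0) (.reg 4) 6 7)
        (.seq (matLoop 13 14 10 (.reg 15) (.reg 1) (.reg 4) 4 8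
            (.mul (.arr 7 (.add (.mul (.reg 13) (.reg 4)) (.reg 10)))
              (.arr 4 (.add (.mul (.reg 10) (.reg 1)) (.reg 14)))))
          completeRows)))

theorem writeMatrix_apply {p q : ℕ} (M : Matrix (Fin p) (Fin q) ℝ) (a : ℕ → ℝ) (i : Fin p)
    (j : Fin q) : writeMatrix M a (i * q + j) = M i j := by
  have hq : 0 < q := j.pos
  have h1 : (i * q + j : ℕ) / q = i := by
    rw [Nat.add_comm, Nat.add_mul_div_right _ _ hq, Nat.div_eq_of_lt j.2, Nat.zero_add]
  have h2 : (i * q + j : ℕ) % q = j := by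
    rw [Nat.add_comm, Nat.add_mul_mod_self_right, Nat.mod_eq_of_lt j.2]
  unfold writeMatrix
  rw [dif_pos ⟨by rw [h1]; exact i.2, hq⟩]
  congr 1 <;> ext <;> simp only [h1, h2]

/-- The decomposition is applied to the `n × r` matrix of coordinates in `V`. If `r < k`, the output
is completed by arbitrary orthonormal rows, which can only lower the price. -/
theorem Runs.finish {d n k m : ℕ} {X : ℕ → Pt d} {R : ℕ} {V : Submodule ℝ (Pt d)} {s : State}
    {P : Fin n → Pt d} (h : HoldsFlat X R V s) (h0 : s.nreg 0 = n) (hk : s.nreg 2 = k)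
    (hkd : k ≤ d) (hP : ∀ i : Fin n, rowVec (s.rarr 0) d i = P i) (h2 : ∀ j, s.rarr 2 j = 0)
    (hn : 0 < n) (hd : 0 < d) (hm : 0 < m) (hrn : s.nreg 4 ≤ n) (hrm : s.nreg 4 ≤ m) (hkm : k ≤ m) :
    Runs ω finish s (400 * (n * d * m)) (fun s' => Module.finrank ℝ (outputFlat k d s') = k ∧
      ∀ G ≤ V, Module.finrank ℝ G ≤ k → price P (outputFlat k d s') ≤ price P G) := by
  set r := s.nreg 4 with hr
  set Q := s.rarr 4 with hQ
  set q : Fin r → Pt d := fun l => rowVec Q d l with hq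
  have hqo : Orthonormal ℝ q := h.basis.orthonormal
  have hqs : Submodule.span ℝ (Set.range q) = V := h.basis.span_range
  have hrd : r ≤ d := h.basis.le_dim
  set M : Matrix (Fin n) (Fin r) ℝ := Matrix.of fun i l => inner ℝ (q l) (P i) with hM
  set b := rightSingularBasis M with hb
  have hbs : IsRightSingularBasis M b := Classical.choose_spec (exists_isRightSingularBasis M)
  have hrow : ∀ (A : ℕ → ℝ) (hA : ∀ i < min r k, ∀ j < d, A (i * d + j) =
      ∑ t ∈ Finset.range r, writeMatrix (Matrix.of fun i j => b i j) (s.rarr 7) (i * r + t) *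
        Q (t * d + j)) (l : ℕ) (hl : l < min r k),
      rowVec A d l = combine q (b ⟨l, by omega⟩) := by
    intro A hA l hl
    ext j
    have := hA l hl j j.2
    simp only [rowVec]
    rw [this, combine_apply, WithLp.ofLp_sum, Finset.sum_apply, Finset.sum_range]
    refine Finset.sum_congr rfl fun t _ => ?_
    have h3 := writeMatrix_apply (Matrix.of fun i j => b i j) (s.rarr 7) ⟨l, by omega⟩ t
    simp only at h3
    rw [h3]
    rfl
  refine Runs.mono (Runs.seq (Runs.ite (t := 2) (Q := fun s' => s'.nreg 15 = min r k)
      (fun hlt => Runs.nset ?_) fun hlt => Runs.nset ?_) fun s₁ a1 J1 =>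
    Runs.seq (Runs.matLoop (p' := n) (q' := r) (N := d)
      (f := fun i l t => s.rarr 0 (i * d + t) * Q (l * d + t)) (by decide) (by decide) (by decide)
      (fun s₂ a2 => ?_) (fun s₂ a2 => ?_) (fun s₂ a2 => ?_)
      fun i hi l hl t ht s₂ a2 e1 e2 e3 => ?_) fun s₂ a2 J2 => Runs.seq (Runs.mono
      (t' := (n + r) * r ^ 2 + 3) (Runs.svd
      (Q := fun s' => s'.rarr 7 = writeMatrix (Matrix.of fun i j => b i j) (s.rarr 7)) ?_)
      ?_ fun _ _ h => h)
    fun s₃ a3 J3 => Runs.seq (Runs.matLoop (p' := min r k) (q' := d) (N := r)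
      (f := fun i j t => writeMatrix (Matrix.of fun i j => b i j) (s.rarr 7) (i * r + t) *
        Q (t * d + j)) (by decide) (by decide) (by decide)
      (fun s₄ a4 => ?_) (fun s₄ a4 => ?_) (fun s₄ a4 => ?_)
      fun i hi j hj t ht s₄ a4 e1 e2 e3 => ?_) fun s₄ a4 J4 =>
    Runs.mono (Runs.completeRows (k := k) (d := d) (r := min r k) ?_ ?_ ?_ (min_le_right _ _) hkd
      ?_ ?_) le_rfl fun s₅ a5 J5 => ?_) ?_ fun _ _ h => h
  · simp only [BExp.holds, NExp.eval, ← hr, hk] at hlt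
    simp only [NExp.eval, Function.update_self, ← hr]
    omega
  · simp only [BExp.holds, NExp.eval, ← hr, hk] at hlt
    simp only [NExp.eval, Function.update_self, hk]
    omega
  · rw [NExp.eval, a2.n 0 rfl, a1.n 0 rfl, h0]
  · rw [NExp.eval, a2.n 4 rfl, a1.n 4 rfl]
  · rw [NExp.eval, a2.n 1 rfl, a1.n 1 rfl, h.dim]
  · simp only [RExp.eval, NExp.eval, e1, e2, e3, a2.n 1 rfl, a1.n 1 rfl, h.dim, a2.a 0 rfl,
      a2.a 4 rfl, a1.a 0 rfl, a1.a 4 rfl, ← hQ]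
  · have g1 : s₂.nreg 0 = n := by rw [a2.n 0 rfl, a1.n 0 rfl, h0]
    have g2 : s₂.nreg 4 = r := by rw [a2.n 4 rfl, a1.n 4 rfl]
    have g3 : readMatrix (s₂.rarr 6) n r = M := by
      ext i l
      have := J2 i i.2 l l.2
      rw [← inner_rowVec, hP, real_inner_comm] at this
      simpa [readMatrix, hM, hq] using this
    have g4 : s₂.rarr 7 = s.rarr 7 := by rw [a2.a 7 rfl, a1.a 7 rfl]
    have gen : ∀ p' q' (B : ℕ → ℝ), p' = n → q' = r →
        writeMatrix (Matrix.of fun i j =>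
          rightSingularBasis (readMatrix (s₂.rarr 6) p' q') i j) B =
        writeMatrix (Matrix.of fun i j =>
          rightSingularBasis (readMatrix (s₂.rarr 6) n r) i j) B := by
      rintro p' q' B rfl hq'
      subst hq'
      rfl
    simp only [Function.update_self]
    refine (gen _ _ _ g1 g2).trans ?_
    rw [g3, g4]
  · have g1 : s₂.nreg 0 = n := by rw [a2.n 0 rfl, a1.n 0 rfl, h0]
    have g2 : s₂.nreg 4 = r := by rw [a2.n 4 rfl, a1.n 4 rfl]
    simp only [NExp.cost, NExp.eval, g1, g2]
    omega
  · rw [NExp.eval, a4.n 15 rfl, a3.n 15 rfl, a2.n 15 rfl, J1]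
  · rw [NExp.eval, a4.n 1 rfl, a3.n 1 rfl, a2.n 1 rfl, a1.n 1 rfl, h.dim]
  · rw [NExp.eval, a4.n 4 rfl, a3.n 4 rfl, a2.n 4 rfl, a1.n 4 rfl]
  · simp only [RExp.eval, NExp.eval, e1, e2, e3, a4.n 1 rfl, a3.n 1 rfl, a2.n 1 rfl, a1.n 1 rfl,
      h.dim, a4.n 4 rfl, a3.n 4 rfl, a2.n 4 rfl, a1.n 4 rfl, ← hr, a4.a 7 rfl, J3, a4.a 4 rfl,
      a3.a 4 rfl, a2.a 4 rfl, a1.a 4 rfl, ← hQ]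
  · rw [a4.n 1 rfl, a3.n 1 rfl, a2.n 1 rfl, a1.n 1 rfl, h.dim]
  · rw [a4.n 2 rfl, a3.n 2 rfl, a2.n 2 rfl, a1.n 2 rfl, hk]
  · rw [a4.n 15 rfl, a3.n 15 rfl, a2.n 15 rfl, J1]
  · intro j
    rw [a4.a 2 rfl, a3.a 2 rfl, a2.a 2 rfl, a1.a 2 rfl, h2]
  · intro i hi j hj
    rw [hrow _ J4 i hi, hrow _ J4 j hj, inner_combine hqo, orthonormal_iff_ite.1 b.orthonormal]
    simp
  · have hout : outputFlat k d s₅ =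
        Submodule.span ℝ (Set.range fun i : Fin k => rowVec (s₅.rarr 2) d i) := rfl
    have ho : Orthonormal ℝ fun i : Fin k => rowVec (s₅.rarr 2) d i := by
      rw [orthonormal_iff_ite]
      intro i j
      rw [J5.1 i i.2 j j.2]
      simp [Fin.ext_iff]
    refine ⟨?_, fun G hG hGk => ?_⟩
    · rw [hout, finrank_span_eq_card ho.linearIndependent, Fintype.card_fin]
    · refine (price_anti P ?_).trans (price_topSingular_le hqo (fun i l => rfl) hbs
        (hG.trans hqs.ge) hGk)
      rw [Submodule.span_le, hout]
      rintro _ ⟨⟨j, hj⟩, rfl⟩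
      refine Submodule.subset_span ⟨⟨j, hj⟩, ?_⟩
      have hlt : (j : ℕ) < min r k := lt_min j.2 hj
      simp only
      rw [J5.2 j hlt, hrow _ J4 j hlt]
  · simp only [RExp.cost, NExp.cost, BExp.cost]
    generalize hr' : min r k = r'
    have hr'r : r' ≤ r := hr' ▸ min_le_left _ _
    have b1 : n * r * d ≤ n * d * m := by
      rw [Nat.mul_right_comm]; exact Nat.mul_le_mul_left _ hrm
    have b2 : n * r ≤ n * r * d := Nat.le_mul_of_pos_right _ hd
    have b3 : n ≤ n * d * m := by
      rw [Nat.mul_assoc]; exact Nat.le_mul_of_pos_right _ (Nat.mul_pos hd hm)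
    -- The cost `(n + r) * r ^ 2` of the decomposition is absorbed by `r ≤ d` here and by `r ≤ n` in
    -- `b5`.
    have b4 : n * r * r ≤ n * r * d := Nat.mul_le_mul_left _ hrd
    have b5 : r * r * r ≤ n * r * r :=
      Nat.mul_le_mul_right _ (Nat.mul_le_mul_right _ hrn)
    have b6 : r' * r * d ≤ n * r * d :=
      Nat.mul_le_mul_right _ (Nat.mul_le_mul_right _ (hr'r.trans hrn))
    have b7 : r' * d ≤ n * d * m :=
      (Nat.mul_le_mul_right _ (hr'r.trans hrn)).trans (Nat.le_mul_of_pos_right _ hm)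
    have b8 : r' ≤ n * d * m := (hr'r.trans hrn).trans b3
    have b9 : k ≤ n * d * m := hkm.trans (Nat.le_mul_of_pos_left _ (Nat.mul_pos hn hd))
    have b10 : r' * k * d ≤ n * d * m := by
      rw [Nat.mul_right_comm]
      exact Nat.mul_le_mul (Nat.mul_le_mul_right _ (hr'r.trans hrn)) hkm
    have b11 : r' * k ≤ r' * k * d := Nat.le_mul_of_pos_right _ hd
    have b12 : 1 ≤ n * d * m := Nat.mul_pos (Nat.mul_pos hn hd) hm
    ring_nf at b1 b2 b3 b4 b5 b6 b7 b8 b9 b10 b11 b12 ⊢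
    omega

end RealRAM

namespace RealRAM

variable {ω : ℕ → unitInterval}

/-! ## The whole program -/

/-- Compute the number of samples in a round and the number of rounds. -/
def countCmd : Cmd :=
  .seq (.seq (.nset 7 (.lit 0))
      (.loop (.rlt (.mul (.ofNat (.reg 7)) (.reg 0)) (.mul (.ofNat (.lit 4)) (.ofNat (.reg 2))))
        (.nset 7 (.add (.reg 7) (.lit 1)))))
    (.seq (.rset 3 (.ofNat (.lit 1)))
      (.loop (.rlt (.mul (.reg 3) (.reg 1)) (.reg 2))
        (.seq (.rset 3 (.add (.reg 3) (.reg 3))) (.nset 6 (.add (.reg 6) (.lit 1))))))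

/-- Without rounding and logarithms, `S` is found by counting and `T` by repeated doubling; both
loops are cheap because `S` and `T` enter the budget anyway. -/
theorem Runs.countCmd {k S T : ℕ} {ε δ c : ℝ} {s : State} (hk : s.nreg 2 = k) (h6 : s.nreg 6 = 0)
    (hε : s.rreg 0 = ε) (hδ : s.rreg 1 = δ) (hc : s.rreg 2 = c)
    (hS : ∀ t : ℕ, t * ε < 4 * k ↔ t < S) (hT : ∀ t < T, 2 ^ t * δ < c) (hT' : c ≤ 2 ^ T * δ) :
    Runs ω countCmd s (15 * S + 14 * T + 22) (fun s' => s'.nreg 7 = S ∧ s'.nreg 6 = T) := by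
  refine Runs.mono (Runs.seq (Runs.seq (Runs.nset (Q := fun s' => s'.nreg 7 = 0) (by simp [NExp.eval]))
    fun s₁ a1 J1 => Runs.loop (N := S) (T := 4) (fun t s' => s'.nreg 7 = t) J1
      (fun t ht s₂ a2 J2 => ⟨?_, Runs.nset ?_⟩) fun s₂ a2 J2 => ?_) fun s₁ a1 J1 =>
    Runs.seq (Runs.rset (Q := fun s' => s'.rreg 3 = 1) (by simp [RExp.eval, NExp.eval]))
    fun s₂ a2 J2 => Runs.mono (Runs.loop (N := T) (T := 8)
      (fun t s' => s'.rreg 3 = 2 ^ t ∧ s'.nreg 6 = t) ?_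
      (fun t ht s₃ a3 J3 => ⟨?_, Runs.seq (Runs.rset (Q := fun s' => s'.rreg 3 = 2 ^ (t + 1)) ?_)
        fun s₄ a4 J4 => Runs.nset ?_⟩) fun s₃ a3 J3 => ?_) le_rfl fun s₃ a3 J3 => ?_) ?_
    fun _ _ h => h
  · simp only [BExp.holds, RExp.eval, NExp.eval, J2, a2.r 0 rfl, a1.r 0 rfl, hε, a2.n 2 rfl,
      a1.n 2 rfl, hk]
    exact_mod_cast (hS t).2 ht
  · simp [NExp.eval, J2]
  · simp only [BExp.holds, RExp.eval, NExp.eval, J2, a2.r 0 rfl, a1.r 0 rfl, hε, a2.n 2 rfl,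
      a1.n 2 rfl, hk]
    intro h
    exact lt_irrefl S ((hS S).1 (by exact_mod_cast h))
  · exact ⟨by simpa using J2, by rw [a2.n 6 rfl, a1.n 6 rfl, h6]⟩
  · simp only [BExp.holds, RExp.eval, J3.1, a3.r 1 rfl, a2.r 1 rfl, a1.r 1 rfl, a3.r 2 rfl,
      a2.r 2 rfl, a1.r 2 rfl, hδ, hc]
    exact hT t ht
  · simp only [RExp.eval, J3.1, Function.update_self]
    ring
  · simp only [NExp.eval, a4.n 6 rfl, J3.2, Function.update_self, and_true]
    exact J4
  · simp only [BExp.holds, RExp.eval, J3.1, a3.r 1 rfl, a2.r 1 rfl, a1.r 1 rfl, a3.r 2 rfl,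
      a2.r 2 rfl, a1.r 2 rfl, hδ, hc]
    exact not_lt.2 hT'
  · exact ⟨by rw [a3.n 7 rfl, a2.n 7 rfl, J1], J3.2⟩
  · simp only [BExp.cost, RExp.cost, NExp.cost]
    omega

/-- Choose between sampling from the given flat and taking all points, and copy the input. -/
def layoutCmd : Cmd :=
  .seq (.ite (.nlt (.add (.mul (.reg 6) (.reg 7)) (.reg 3)) (.reg 0))
      (.seq (.nset 5 (.add (.reg 0) (.reg 3))) (.seq (.nset 12 (.reg 0)) (.nset 11 (.reg 3))))
      (.seq (.nset 5 (.reg 0)) (.seq (.nset 12 (.lit 0)) (.seq (.nset 11 (.reg 0))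
        (.nset 6 (.lit 0))))))
    (.seq (fillLoop 10 (.mul (.reg 0) (.reg 1)) 3 (.reg 10) (.arr 0 (.reg 10)))
      (fillLoop 10 (.mul (.sub (.reg 5) (.reg 0)) (.reg 1)) 3
        (.add (.mul (.reg 0) (.reg 1)) (.reg 10)) (.arr 1 (.reg 10))))

/-- The points, followed by the basis vectors of the given flat. -/
noncomputable def inputPts {n d u : ℕ} (P : Fin n → Pt d) (B : Fin u → Pt d) (i : ℕ) : Pt d :=
  if h : i < n then P ⟨i, h⟩ else if h : i - n < u then B ⟨i - n, h⟩ else 0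

theorem inputPts_left {n d u : ℕ} (P : Fin n → Pt d) (B : Fin u → Pt d) (i : Fin n) :
    inputPts P B i = P i := by
  simp [inputPts]

theorem inputPts_right {n d u : ℕ} (P : Fin n → Pt d) (B : Fin u → Pt d) (i : Fin u) :
    inputPts P B (n + i) = B i := by
  simp [inputPts]

/-- The registers after the choice of the layout. -/
structure Layout (n u S T : ℕ) (s : State) : Prop where
  reg5 : s.nreg 5 = if T * S + u < n then n + u else n
  reg12 : s.nreg 12 = if T * S + u < n then n else 0
  reg11 : s.nreg 11 = if T * S + u < n then u else n
  reg6 : s.nreg 6 = if T * S + u < n then T else 0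

theorem Layout.congr {n u S T : ℕ} {s s' : State} (h : Layout n u S T s) {c : Cmd}
    (ha : Agree c s s') (hc : c.setsN 5 = false ∧ c.setsN 12 = false ∧ c.setsN 11 = false ∧
      c.setsN 6 = false) : Layout n u S T s' :=
  ⟨by rw [ha.n 5 hc.1, h.reg5], by rw [ha.n 12 hc.2.1, h.reg12], by rw [ha.n 11 hc.2.2.1, h.reg11],
    by rw [ha.n 6 hc.2.2.2, h.reg6]⟩

theorem Runs.layoutCmd {n d u S T : ℕ} {s : State} {P : Fin n → Pt d} {B : Fin u → Pt d}
    (h0 : s.nreg 0 = n) (h1 : s.nreg 1 = d) (h3 : s.nreg 3 = u) (h4 : s.nreg 4 = 0)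
    (h7 : s.nreg 7 = S) (h6 : s.nreg 6 = T)
    (hP : ∀ i : Fin n, rowVec (s.rarr 0) d i = P i) (hB : ∀ i : Fin u, rowVec (s.rarr 1) d i = B i) :
    Runs ω layoutCmd s (14 * (n * d) + 20 * ((if T * S + u < n then u else 0) * d) + 34)
      (fun s' => Layout n u S T s' ∧ HoldsFlat (inputPts P B) (s'.nreg 5) ⊥ s') := by
  refine Runs.mono (Runs.seq (Runs.ite (t := 8) (Q := Layout n u S T)
      (fun hb => ?_) fun hb => ?_) fun s₁ a1 J1 =>
    Runs.seq (Runs.fillLoop (N := n * d) (o := 0) (f := fun t => s.rarr 0 t)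
      (fun s₂ a2 => ?_) fun t ht s₂ a2 e2 J2 => ?_) fun s₂ a2 J2 => Runs.mono
    (Runs.fillLoop (N := (if T * S + u < n then u else 0) * d) (o := n * d)
      (f := fun t => s.rarr 1 t)
      (fun s₃ a3 => ?_) fun t ht s₃ a3 e3 J3 => ?_) le_rfl fun s₃ a3 J3 => ?_) ?_ fun _ _ h => h
  · simp only [BExp.holds, NExp.eval, h6, h7, h3, h0] at hb
    refine Runs.seq (Runs.nset (Q := fun s' => s'.nreg 5 = n + u) (by simp [NExp.eval, h0, h3]))
      fun s₁ a1 J1 => Runs.seq (Runs.nset (Q := fun s' => s'.nreg 12 = n)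
        (by simp [NExp.eval, a1.n 0 rfl, h0])) fun s₂ a2 J2 => Runs.nset ?_
    constructor <;> simp [hb, NExp.eval, a2.n 3 rfl, a1.n 3 rfl, a2.n 5 rfl, a2.n 6 rfl, a1.n 6 rfl,
      J1, J2, h3, h6]
  · simp only [BExp.holds, NExp.eval, h6, h7, h3, h0] at hb
    refine Runs.seq (Runs.nset (Q := fun s' => s'.nreg 5 = n) (by simp [NExp.eval, h0]))
      fun s₁ a1 J1 => Runs.seq (Runs.nset (Q := fun s' => s'.nreg 12 = 0)
        (by simp [NExp.eval])) fun s₂ a2 J2 => Runs.seq (Runs.nset (Q := fun s' => s'.nreg 11 = n)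
        (by simp [NExp.eval, a2.n 0 rfl, a1.n 0 rfl, h0])) fun s₃ a3 J3 => Runs.nset ?_
    constructor <;> simp [hb, NExp.eval, a3.n 5 rfl, a2.n 5 rfl, a3.n 12 rfl, J1, J2, J3]
  · simp only [NExp.eval, a2.n 0 rfl, a2.n 1 rfl, a1.n 0 rfl, a1.n 1 rfl, h0, h1]
  · simp only [NExp.eval, RExp.eval, e2, a2.a 0 rfl, a1.a 0 rfl, zero_add, and_self]
  · simp only [NExp.eval, a3.n 0 rfl, a3.n 1 rfl, a3.n 5 rfl, a2.n 0 rfl, a2.n 1 rfl, a2.n 5 rfl,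
      a1.n 0 rfl, a1.n 1 rfl, h0, h1, J1.reg5]
    congr 1
    split_ifs <;> omega
  · simp only [NExp.eval, RExp.eval, e3, a3.n 0 rfl, a3.n 1 rfl, a2.n 0 rfl, a2.n 1 rfl,
      a1.n 0 rfl, a1.n 1 rfl, h0, h1, a3.a 1 rfl, a2.a 1 rfl, a1.a 1 rfl, and_self]
  · have hlay : Layout n u S T s₃ :=
      (J1.congr a2 ⟨rfl, rfl, rfl, rfl⟩).congr a3 ⟨rfl, rfl, rfl, rfl⟩
    refine ⟨hlay, ⟨?_, rfl, ?_, fun l hl => ?_⟩⟩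
    · rw [a3.n 1 rfl, a2.n 1 rfl, a1.n 1 rfl, h1]
    · rw [a3.n 4 rfl, a2.n 4 rfl, a1.n 4 rfl, h4]
      exact OrthoRows.zero _ _
    · suffices h : rowVec (s₃.rarr 3) d l = inputPts P B l by
        rw [h]; exact isResid_bot _
      rcases lt_or_ge l n with hln | hln
      · have h5 := inputPts_left P B ⟨l, hln⟩
        simp only at h5
        rw [h5, ← hP]
        refine rowVec_congr fun t ht => ?_
        have h6 : (l + 1) * d ≤ n * d := Nat.mul_le_mul_right d hln
        rw [Nat.succ_mul] at h6
        rw [J3.2 _ (Or.inl (by omega))]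
        have := J2.1 (l * d + t) (by omega)
        rwa [zero_add] at this
      · rw [hlay.reg5] at hl
        split_ifs at hl with hc
        · obtain ⟨l', rfl⟩ := Nat.exists_eq_add_of_le hln
          have h5 := inputPts_right P B ⟨l', by omega⟩
          simp only at h5
          rw [h5, ← hB]
          refine rowVec_congr fun t ht => ?_
          have h6 : (l' + 1) * d ≤ u * d := Nat.mul_le_mul_right d (by omega)
          rw [Nat.succ_mul] at h6
          have := J3.1 (l' * d + t) (by rw [if_pos hc]; omega)
          rw [Nat.add_mul, Nat.add_assoc]
          exact this
        · omega
  · simp only [BExp.cost, RExp.cost, NExp.cost]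
    omega

/-- The program of the theorem. -/
def flatProgram : Cmd :=
  .seq countCmd (.seq layoutCmd (.seq addRows (.seq sampleLoop finish)))

theorem price_eq_zero_of_mem {n d : ℕ} {P : Fin n → Pt d} {V : Submodule ℝ (Pt d)}
    (h : ∀ i, P i ∈ V) : price P V = 0 :=
  le_antisymm (by simpa using price_le_of_mem (P := P) (y := P) h) (price_nonneg P V)

theorem exists_of_not_isBad {n d k : ℕ} {P : Fin n → Pt d} {ε : ℝ} {V G₀ : Submodule ℝ (Pt d)}
    (h : ¬ IsBad P k ε V)
    (hG : ∀ G ≤ V, Module.finrank ℝ G ≤ k → price P G₀ ≤ price P G) :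
    price P G₀ ≤ (1 + ε) * optPrice P k := by
  unfold IsBad at h
  push Not at h
  obtain ⟨G, h1, h2, h3⟩ := h
  exact (hG G h1 h2).trans h3

/-- Sampling is used only if `T * S + u < n`: then at most `2 * n` rows are stored and the rank
stays below `n`. Otherwise adding all `n` points is no more expensive than the budget `n * d * (T *
S + u)` up to a constant. -/
theorem Runs.flatProgram {n d k u S T : ℕ} {ε δ c : ℝ} {P : Fin n → Pt d} {B : Fin u → Pt d}
    (hn : 0 < n) (hk : 0 < k) (hkd : k ≤ d) (hε : 0 < ε) (hS0 : k ≤ S) (hT0 : 0 < T)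
    (hS : ∀ t : ℕ, t * ε < 4 * k ↔ t < S) (hT : ∀ t < T, 2 ^ t * δ < c) (hT' : c ≤ 2 ^ T * δ) :
    Runs ω flatProgram (start P B k ε δ c) (1500 * (n * d * (T * S + u))) (fun s' =>
      Module.finrank ℝ (outputFlat k d s') = k ∧
      (¬ IsBad P k ε (adaptiveFlat (inputPts P B) n S T (Submodule.span ℝ (Set.range B)) ω) →
        price P (outputFlat k d s') ≤ (1 + ε) * optPrice P k)) := by
  have hd : 0 < d := by omega
  have hS1 : 0 < S := by omega
  set m := T * S + u with hm_def
  have hSm : S ≤ m := (Nat.le_mul_of_pos_left S hT0).trans (Nat.le_add_right _ _)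
  have hTm : T ≤ m := (Nat.le_mul_of_pos_right T hS1).trans (Nat.le_add_right _ _)
  set s := start P B k ε δ c with hs
  have hP : ∀ i : Fin n, rowVec (s.rarr 0) d i = P i := fun i => by
    ext j
    exact writeMatrix_apply (Matrix.of fun i j => P i j) (fun _ => 0) i j
  have hB : ∀ i : Fin u, rowVec (s.rarr 1) d i = B i := fun i => by
    ext j
    exact writeMatrix_apply (Matrix.of fun i j => B i j) (fun _ => 0) i j
  set X := inputPts P B with hX
  set R := if m < n then n + u else n with hR
  have hnR : n ≤ R := by rw [hR]; split_ifs <;> omega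
  refine Runs.mono (Runs.seq (Runs.countCmd (k := k) (S := S) (T := T) (ε := ε) (δ := δ) (c := c)
      rfl rfl rfl rfl rfl hS hT hT') fun s₁ a1 J1 => Runs.seq (Runs.layoutCmd (P := P) (B := B)
      (d := d) (u := u) (S := S) (T := T) ?_ ?_ ?_ ?_ J1.1 J1.2 ?_ ?_) fun s₂ a2 J2 =>
    Runs.seq (Runs.addRows (X := X) (R := R) (lo := if m < n then n else 0)
      (m := if m < n then u else n) ?_ ?_ hd J2.1.reg12 J2.1.reg11 ?_) fun s₃ a3 J3 =>
    Runs.seq (Runs.sampleLoop (n := n) (S := S) (T := if m < n then T else 0)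
      J3.1 hd hn ?_ ?_ ?_ hS1 hnR) fun s₄ a4 J4 =>
    Runs.mono (Runs.finish (P := P) (k := k) (m := m) J4.1 ?_ ?_ hkd ?_ ?_ hn hd (by omega) ?_ ?_
      (by omega)) le_rfl fun s₅ a5 J5 => ?_) ?_ fun _ _ h => h
  · rw [a1.n 0 rfl]; rfl
  · rw [a1.n 1 rfl]; rfl
  · rw [a1.n 3 rfl]; rfl
  · rw [a1.n 4 rfl]; rfl
  · rw [a1.a 0 rfl]; exact hP
  · rw [a1.a 1 rfl]; exact hB
  · have := J2.2
    rwa [J2.1.reg5] at this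
  · rw [a2.n 4 rfl, a1.n 4 rfl]; rfl
  · rw [hR]; split_ifs <;> omega
  · rw [a3.n 0 rfl, a2.n 0 rfl, a1.n 0 rfl]; rfl
  · rw [a3.n 7 rfl, a2.n 7 rfl, J1.1]
  · rw [a3.n 6 rfl, J2.1.reg6]
  · rw [a4.n 0 rfl, a3.n 0 rfl, a2.n 0 rfl, a1.n 0 rfl]; rfl
  · rw [a4.n 2 rfl, a3.n 2 rfl, a2.n 2 rfl, a1.n 2 rfl]; rfl
  · rw [a4.a 0 rfl, a3.a 0 rfl, a2.a 0 rfl, a1.a 0 rfl]; exact hP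
  · rw [a4.a 2 rfl, a3.a 2 rfl, a2.a 2 rfl, a1.a 2 rfl]; exact fun j => rfl
  · have h1 := J3.2
    have h2 := J4.2
    split_ifs at h1 h2 <;> omega
  · have h1 := J3.2
    have h2 := J4.2
    split_ifs at h1 h2 <;> omega
  · refine ⟨J5.1, fun hbad => ?_⟩
    have hopt := J5.2
    have hpos : s₃.pos = 0 := by rw [a3.p rfl, a2.p rfl, a1.p rfl]; rfl
    have hdrop : dropSeq s₃.pos ω = ω := by
      funext j; simp [dropSeq, hpos]
    rw [hdrop] at hopt
    split_ifs at hopt with hc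
    · have himg : X '' Set.Ico n (n + u) = Set.range B := by
        ext x
        simp only [Set.mem_image, Set.mem_Ico, Set.mem_range]
        constructor
        · rintro ⟨i, ⟨h1, h2⟩, rfl⟩
          obtain ⟨i', rfl⟩ := Nat.exists_eq_add_of_le h1
          exact ⟨⟨i', by omega⟩, (inputPts_right P B ⟨i', by omega⟩).symm⟩
        · rintro ⟨i, rfl⟩
          exact ⟨n + i, ⟨by omega, by omega⟩, inputPts_right P B i⟩
      rw [himg] at hopt
      exact exists_of_not_isBad hbad hopt
    -- In the branch that takes all points there are no sampling rounds, and the output is good for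
    -- every sequence of random numbers.
    · refine exists_of_not_isBad (not_isBad_of_price_eq_zero hε hkd ?_) hopt
      refine price_eq_zero_of_mem fun i => ?_
      rw [← inputPts_left P B i]
      exact Submodule.subset_span ⟨i, ⟨by omega, by omega⟩, rfl⟩
  · have b1 : m ≤ n * d * m := Nat.le_mul_of_pos_left _ (Nat.mul_pos hn hd)
    have b2 : n * d ≤ n * d * m := Nat.le_mul_of_pos_right _ (by omega)
    have b3 : 1 ≤ m := by omega
    have b4 : n ≤ n * d := Nat.le_mul_of_pos_right _ hd
    rw [← hm_def, hR]
    split_ifs with hc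
    · have b5 : u * d ≤ n * d := Nat.mul_le_mul_right _ (by omega)
      have b6 : (n + u) * d ≤ 2 * (n * d) := by rw [Nat.add_mul]; omega
      have b7 : u * (160 * ((n + u) * d) + 12) ≤ u * (332 * (n * d)) :=
        Nat.mul_le_mul_left _ (by have := Nat.mul_pos hn hd; omega)
      have b8 : T * (302 * (S * ((n + u) * d)) + 8) ≤ T * (612 * (S * (n * d))) := by
        refine Nat.mul_le_mul_left _ ?_
        have c1 : S * ((n + u) * d) ≤ S * (2 * (n * d)) := Nat.mul_le_mul_left _ b6
        have c2 : 1 ≤ S * (n * d) := Nat.mul_pos hS1 (Nat.mul_pos hn hd)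
        have c3 : S * (2 * (n * d)) = 2 * (S * (n * d)) := by ring
        omega
      have b9 : T * (612 * (S * (n * d))) + u * (332 * (n * d)) ≤ 612 * (n * d * m) := by
        rw [hm_def]
        have : 612 * (n * d * (T * S + u)) = T * (612 * (S * (n * d))) + u * (612 * (n * d)) := by
          ring
        rw [this]
        exact Nat.add_le_add_left (Nat.mul_le_mul_left _ (by omega)) _
      omega
    · have b7 : n * (160 * (n * d) + 12) ≤ m * (172 * (n * d)) :=
        Nat.mul_le_mul (by omega) (by omega)
      have b8 : m * (172 * (n * d)) = 172 * (n * d * m) := by ring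
      omega

end RealRAM

/-- There is one randomized real RAM program that works for all inputs and parameters; the constant
`C` in the running time depends only on the constant `A` for which the given flat has dimension at
most `A * k`. -/
theorem mainTheorem3 :
    ∃ prog : RealRAM.Cmd, ∀ A : ℕ, ∃ C : ℝ,
      ∀ (n d k u : ℕ), 1 ≤ n → 1 ≤ k → k ≤ d → u ≤ A * k →
      ∀ (P : Fin n → Pt d) (B : Fin u → Pt d), LinearIndependent ℝ B →
      ∀ (ε δ c : ℝ), 0 < ε → ε ≤ 1 → 0 < δ → δ < 1 → 1 ≤ c →
        price P (Submodule.span ℝ (Set.range B)) ≤ c * optPrice P k →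
        (∀ ω : ℕ → unitInterval, ∃ (t : ℕ) (s : RealRAM.State),
          RealRAM.Exec ω prog (RealRAM.start P B k ε δ c) t s ∧
          (t : ℝ) ≤ C * ((n * d : ℝ) * (k / ε) * (1 + Real.log (c / δ))) ∧
          Module.finrank ℝ (RealRAM.outputFlat k d s) = k) ∧
        RealRAM.coins {ω | ¬ ∃ (t : ℕ) (s : RealRAM.State),
          RealRAM.Exec ω prog (RealRAM.start P B k ε δ c) t s ∧
          price P (RealRAM.outputFlat k d s) ≤ (1 + ε) * optPrice P k} ≤ ENNReal.ofReal δ := by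
  classical
  -- The `10` is the product of the factor `5` in `hSle` and the factor `2` in `hTle`; `A` accounts
  -- for the basis of the given flat.
  refine ⟨RealRAM.flatProgram, fun A => ⟨1500 * (10 + A), ?_⟩⟩
  intro n d k u hn hk hkd hu P B _ ε δ c hε hε1 hδ hδ1 hc hprice
  set S := ⌈4 * (k : ℝ) / ε⌉₊ with hS_def
  have hS : ∀ t : ℕ, t * ε < 4 * k ↔ t < S := fun t => by
    rw [hS_def, Nat.lt_ceil, lt_div_iff₀ hε]
  have hex : ∃ T : ℕ, c ≤ 2 ^ T * δ := by
    obtain ⟨T, hT⟩ := pow_unbounded_of_one_lt (c / δ) one_lt_two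
    exact ⟨T, by rw [div_lt_iff₀ hδ] at hT; exact hT.le⟩
  set T := Nat.find hex with hT_def
  have hT' : c ≤ 2 ^ T * δ := Nat.find_spec hex
  have hT : ∀ t < T, 2 ^ t * δ < c := fun t ht => not_le.1 (Nat.find_min hex ht)
  have hk1 : (1 : ℝ) ≤ k := by exact_mod_cast hk
  have hSε : 4 * (k : ℝ) ≤ S * ε := by
    rw [← div_le_iff₀ hε]; exact Nat.le_ceil _
  have hkS : k ≤ S := by
    have : (k : ℝ) ≤ S := by nlinarith [(Nat.cast_nonneg S : (0 : ℝ) ≤ S)]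
    exact_mod_cast this
  have hT0 : 0 < T := by
    rw [Nat.pos_iff_ne_zero]
    intro h
    rw [h] at hT'
    linarith
  have hrun := fun ω : ℕ → unitInterval => RealRAM.Runs.flatProgram (ω := ω) (P := P) (B := B)
    hn hk hkd hε hkS hT0 hS hT hT'
  have hL : 0 ≤ Real.log (c / δ) := Real.log_nonneg (by rw [le_div_iff₀ hδ]; linarith)
  have hkε : (k : ℝ) ≤ k / ε := by
    rw [le_div_iff₀ hε]; nlinarith
  -- The rounding error of at most one is absorbed since `k / ε ≥ 1`.
  have hSle : (S : ℝ) ≤ 5 * (k / ε) := by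
    have := (Nat.ceil_lt_add_one (a := 4 * (k : ℝ) / ε) (by positivity)).le
    rw [mul_div_assoc] at this
    rw [hS_def, mul_div_assoc]
    linarith
  -- Minimality of `T` gives `2 ^ (T - 1) ≤ c / δ`; the factor `2` comes from `log 2 > 1 / 2`.
  have hTle : (T : ℝ) ≤ 2 * (1 + Real.log (c / δ)) := by
    have h1 : (2 : ℝ) ^ (T - 1) ≤ c / δ := by
      rw [le_div_iff₀ hδ]; exact (hT (T - 1) (by omega)).le
    have h2 := Real.log_le_log (by positivity) h1
    rw [Real.log_pow] at h2
    have h3 := Real.log_two_gt_d9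
    have h4 : (T : ℝ) = ((T - 1 : ℕ) : ℝ) + 1 := by
      rw [← Nat.cast_succ]; congr 1; omega
    have h5 : (0 : ℝ) ≤ ((T - 1 : ℕ) : ℝ) := Nat.cast_nonneg _
    nlinarith
  have hm : ((T * S + u : ℕ) : ℝ) ≤ (10 + A) * ((k / ε) * (1 + Real.log (c / δ))) := by
    push_cast
    have h1 : (T : ℝ) * S ≤ 2 * (1 + Real.log (c / δ)) * (5 * (k / ε)) :=
      mul_le_mul hTle hSle (Nat.cast_nonneg _) (by positivity)
    have h2 : (u : ℝ) ≤ A * k := by exact_mod_cast hu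
    have h3 : (A : ℝ) * k ≤ A * ((k / ε) * (1 + Real.log (c / δ))) := by
      refine mul_le_mul_of_nonneg_left ?_ (Nat.cast_nonneg _)
      have : 0 ≤ (k : ℝ) / ε := by positivity
      nlinarith
    linarith
  constructor
  · intro ω
    obtain ⟨t, s, ht, hex, hfin, -⟩ := hrun ω
    refine ⟨t, s, hex, ?_, hfin⟩
    have h1 : (t : ℝ) ≤ 1500 * (n * d * ((T * S + u : ℕ) : ℝ)) := by exact_mod_cast ht
    have h2 : (n : ℝ) * d * ((T * S + u : ℕ) : ℝ) ≤
        n * d * ((10 + A) * ((k / ε) * (1 + Real.log (c / δ)))) :=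
      mul_le_mul_of_nonneg_left hm (by positivity)
    calc (t : ℝ) ≤ 1500 * (n * d * ((T * S + u : ℕ) : ℝ)) := h1
      _ ≤ 1500 * (n * d * ((10 + A) * ((k / ε) * (1 + Real.log (c / δ))))) := by linarith
      _ = _ := by ring
  -- The failure set is only shown to lie inside the bad event, so its own measurability is not
  -- needed.
  · refine (measure_mono ?_).trans (coins_isBad_adaptiveFlat_le (k := k) (s := S) (T := T) hn hkd
      (RealRAM.inputPts_left P B) hε hε1 (by omega) hSε hT' hT0 hprice)
    intro ω hω
    by_contra hbad
    obtain ⟨t, s, -, hex, -, hgood⟩ := hrun ω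
    exact hω ⟨t, s, hex, hgood hbad⟩
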